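/- Let $A\in\mathbb R^{n\times n}$, $B\in\mathbb R^{n\times m}$, $C\in\mathbb R^{p\times n}$, $D\in\mathbb R^{p\times m}$ with $R:=DD^\top$ positive definite and $BD^\top=0$, and put $Q:=BB^\top$. For positive semidefinite $X$ let $$r(X):=AXA^\top-AXC^\top(CXC^\top+R)^{-1}CXA^\top+Q .$$ For a positive semidefinite $P$ let $P^+$ be its pseudo inverse, $\det^+P$ the product of its nonzero eigenvalues, $\Pi_P$ the orthogonal projection onto $\mathrm{Im}(P)$, and for $\lambda>\sigma_{\max}(P)$ (the largest eigenvalue), $\lambda>0$, set $$\tilde P_\lambda:=(P^+-\lambda^{-1}\Pi_P)^+,\qquad \gamma(P,\lambda):=\tfrac12\left\{\ln{\det}^+P-\ln{\det}^+\tilde P_\lambda+\mathrm{tr}(P^+\tilde P_\lambda)-\mathrm{rank}(P)\right\}.$$ For $c>0$ let $r_c(P):=r(\tilde P_\lambda)$, where $\lambda>\sigma_{\max}(P)$ is the solution of $\gamma(P,\lambda)=c$ (if $P=0$, then $\tilde P_\lambda=0$ for every $\lambda$, and $r_c(0):=r(0)=Q$). Assume that $(A,B)$ is stabilizable and that the reachable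 subsystem is observable, i.e. the only vector $x$ in the reachable subspace $\sum_{k\ge0}\mathrm{Im}(A^kB)$ with $CA^kx=0$ for all $k\ge 0$ is $x=0$. Then the classical iteration $\bar P_{t+1}=r(\bar P_t)$ converges, from every positive semidefinite initial condition $\bar P_0$, to one and the same matrix $\bar P_\infty$. Moreover, let $U\in\mathbb R^{n\times l}$ be any matrix whose columns form an orthonormal basis of $\mathrm{Im}(\bar P_\infty)$. Then there is $c_{MAX}>0$ such that for every $c$ with $0<c<c_{MAX}$ there is a unique positive definite $P_\infty^R\in\mathbb R^{l\times l}$ such that, for every positive semidefinite $P_0$ with $\mathrm{Im}(P_0)\subseteq\mathrm{Im}(U)$, the sequence generated by $P_{t+1}=r_c(P_t)$ satisfies $$P_t^R:=U^\top P_tU\longrightarrow P_\infty^R\qquad(t\to\infty).$$ -/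

import Mathlib

open Filter Topology

noncomputable section

namespace LowRankRiccati

/-- The image of a real matrix. -/
def im {n k : ℕ} (M : Matrix (Fin n) (Fin k) ℝ) : Submodule ℝ (Fin n → ℝ) :=
  LinearMap.range M.mulVecLin

/-- Discrete-time stabilizability of `(A, B)`: some state feedback places all the (complex)
eigenvalues of the closed-loop matrix in the open unit disc. -/
def Stabilizable {n m : ℕ} (A : Matrix (Fin n) (Fin n) ℝ) (B : Matrix (Fin n) (Fin m) ℝ) : Prop :=
  ∃ K : Matrix (Fin m) (Fin n) ℝ,
    ∀ z ∈ spectrum ℂ ((A + B * K).map (algebraMap ℝ ℂ)), ‖z‖ < 1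

/-- The reachable subspace of `(A, B)`: the sum of the images of `B, A B, A² B, …`. -/
def reachableSubspace {n m : ℕ} (A : Matrix (Fin n) (Fin n) ℝ) (B : Matrix (Fin n) (Fin m) ℝ) :
    Submodule ℝ (Fin n → ℝ) :=
  ⨆ k : ℕ, im (A ^ k * B)

/-- Observability of the reachable subsystem, i.e. of the restriction of `(A, C)` to the
(`A`-invariant) reachable subspace of `(A, B)`: the only reachable state whose free output
`C x, C A x, C A² x, …` vanishes identically is `0`. -/
def ReachableSubsystemObservable {n m p : ℕ} (A : Matrix (Fin n) (Fin n) ℝ)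
    (B : Matrix (Fin n) (Fin m) ℝ) (C : Matrix (Fin p) (Fin n) ℝ) : Prop :=
  ∀ x ∈ reachableSubspace A B, (∀ k : ℕ, (C * A ^ k).mulVec x = 0) → x = 0

/-- The pseudo inverse `M⁺` of a symmetric matrix, through the spectral decomposition: each
nonzero eigenvalue is inverted, and the kernel is kept (recall `0⁻¹ = 0`). -/
def pinv {n : ℕ} (M : Matrix (Fin n) (Fin n) ℝ) : Matrix (Fin n) (Fin n) ℝ :=
  cfc (fun x : ℝ => x⁻¹) M

/-- The pseudo determinant `det⁺ M` of a symmetric matrix, the product of its nonzero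
eigenvalues: the zero eigenvalues are replaced by `1` before taking the determinant. -/
def pdet {n : ℕ} (M : Matrix (Fin n) (Fin n) ℝ) : ℝ :=
  (cfc (fun x : ℝ => if x = 0 then 1 else x) M).det

/-- The orthogonal projection onto the image of a symmetric matrix, `M M⁺`. It equals `Hᵀ H`
whenever the columns of `Hᵀ` form an orthonormal basis of the image of `M`. -/
def imProj {n : ℕ} (M : Matrix (Fin n) (Fin n) ℝ) : Matrix (Fin n) (Fin n) ℝ :=
  M * pinv M

/-- The perturbed covariance `(P⁺ - lam⁻¹ Hᵀ H)⁺` for the multiplier `lam`. -/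
def tilde {n : ℕ} (P : Matrix (Fin n) (Fin n) ℝ) (lam : ℝ) : Matrix (Fin n) (Fin n) ℝ :=
  pinv (pinv P - lam⁻¹ • imProj P)

/-- `γ(P, lam)`: the relative entropy between the centred (possibly degenerate) Gaussians with
covariances `tilde P lam` and `P`. -/
def gam {n : ℕ} (P : Matrix (Fin n) (Fin n) ℝ) (lam : ℝ) : ℝ :=
  1 / 2 * (Real.log (pdet P) - Real.log (pdet (tilde P lam))
    + ((pinv P * tilde P lam).trace - (P.rank : ℝ)))

/-- `lam` is a multiplier for the tolerance `c`: it exceeds the largest eigenvalue of `P`, and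
`γ(P, lam) = c`. -/
def IsMultiplier {n : ℕ} (c : ℝ) (P : Matrix (Fin n) (Fin n) ℝ) (lam : ℝ) : Prop :=
  0 < lam ∧ (∀ s ∈ spectrum ℝ P, s < lam) ∧ gam P lam = c

/-- The multiplier for the tolerance `c`. For `c > 0` and `P ≠ 0` positive semidefinite there is
exactly one. For `P = 0` there is none, but then `tilde P lam = 0` whatever `lam` is. -/
def multiplier {n : ℕ} (c : ℝ) (P : Matrix (Fin n) (Fin n) ℝ) : ℝ :=
  Classical.epsilon (IsMultiplier c P)

/-- The classical Riccati map, with `Q = B Bᵀ` and `R = D Dᵀ`. -/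
def riccati {n m p : ℕ} (A : Matrix (Fin n) (Fin n) ℝ) (B : Matrix (Fin n) (Fin m) ℝ)
    (C : Matrix (Fin p) (Fin n) ℝ) (D : Matrix (Fin p) (Fin m) ℝ)
    (X : Matrix (Fin n) (Fin n) ℝ) : Matrix (Fin n) (Fin n) ℝ :=
  A * X * A.transpose
    - A * X * C.transpose * (C * X * C.transpose + D * D.transpose)⁻¹ * C * X * A.transpose
    + B * B.transpose

/-- The distorted Riccati map `r_c`: the classical one, evaluated at the perturbed covariance. -/
def robustRiccati {n m p : ℕ} (A : Matrix (Fin n) (Fin n) ℝ) (B : Matrix (Fin n) (Fin m) ℝ)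
    (C : Matrix (Fin p) (Fin n) ℝ) (D : Matrix (Fin p) (Fin m) ℝ) (c : ℝ)
    (P : Matrix (Fin n) (Fin n) ℝ) : Matrix (Fin n) (Fin n) ℝ :=
  riccati A B C D (tilde P (multiplier c P))

end LowRankRiccati

end

/-!
Everything is compared in the Löwner order, with `r` the classical Riccati map, `F` the robust one
and `Ā` the closed-loop matrix `A - K C` at the limit `P̄`.

*The classical iteration.* The map `r` is monotone, being a minimum over gains
(`riccati_add_sq`). A dead-beat observer with time-varying gains bounds `r^N(X)` uniformly over all
positive semidefinite `X` supported on the reachable subspace (`exists_uniform_bound`), so `r^t(0)`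
increases to a fixed point `P̄`. A left eigenvector of `Ā` with an eigenvalue of modulus at least
`1` would contradict stabilizability (`tendsto_pow_closedLoop`), hence `Ā^t → 0`, and
`r^t(0) ≤ r^t(X) ≤ P̄ + Ā^t (X - P̄) (Ā^t)ᵀ` gives convergence from every `X`.

*Size of the perturbation.* With `θ = 1 / lam` the perturbed covariance is `(1 - θ P)⁻¹ P`, and
`γ` is a sum of increasing functions of the numbers `θ σ`, with `σ` the eigenvalues of `P`
(`gam_eq_sum`). So a tolerance that is small enough forces `θ P ≤ ε`, the perturbation lies between
`P` and `(1 - ε)⁻¹ P`, and, `r` being monotone and subhomogeneous,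
`r^t(X) ≤ F^t(X) ≤ (1 - ε)^(-t) r^t(X)` (`iterate_robustRiccati_bounds`). Together with the uniform
bound this puts all robust trajectories, after a common time, into any prescribed neighbourhood
of `P̄`, provided `ε` is small (`exists_absorption`).

*Contraction near `P̄`.* The exact identity `robustRiccati_sub` reads
`F(P) - F(P') = M (P - P' + (θ - θ') P P') M'ᵀ`, with `M` and `M'` close to `Ā`. The relative
entropy is monotone in `P` (`log_det_add_trace_inv_le`), so `θ` is antitone and homogeneous of
degree `-1` in `P`, which makes it Lipschitz with a small constant (`abs_theta_sub_le`). Differences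
of trajectories thus follow `X ↦ Ā X Āᵀ` up to a small relative error, and their norms are halved
every `j` steps (`exists_halving`): the trajectories are Cauchy and share their limit. The image of
`P̄` enters through the projection `U Uᵀ`, which all the iterates respect and which bounds them from
below, so that the compressed limit is positive definite.
-/

open scoped Matrix

noncomputable section

namespace LowRankRiccati

/-! ### The Löwner order and the operator norm -/

section Order
open scoped MatrixOrder Matrix.Norms.L2Operator

variable {n m p : ℕ}

theorem conj_nonneg {X : Matrix (Fin n) (Fin n) ℝ} (hX : 0 ≤ X) (M : Matrix (Fin m) (Fin n) ℝ) :
    0 ≤ M * X * Mᵀ := by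
  rw [Matrix.nonneg_iff_posSemidef] at *
  simpa using hX.mul_mul_conjTranspose_same M

theorem conj_mono {X Y : Matrix (Fin n) (Fin n) ℝ} (h : X ≤ Y) (M : Matrix (Fin m) (Fin n) ℝ) :
    M * X * Mᵀ ≤ M * Y * Mᵀ := by
  have := conj_nonneg (sub_nonneg.2 h) M
  rwa [Matrix.mul_sub, Matrix.sub_mul, sub_nonneg] at this

theorem transpose_eq_of_nonneg {X : Matrix (Fin n) (Fin n) ℝ} (hX : 0 ≤ X) : Xᵀ = X := by
  simpa using (Matrix.nonneg_iff_posSemidef.1 hX).1.eq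

theorem mul_transpose_self_nonneg (M : Matrix (Fin n) (Fin m) ℝ) : 0 ≤ M * Mᵀ := by
  rw [Matrix.nonneg_iff_posSemidef]
  simpa using Matrix.posSemidef_self_mul_conjTranspose M

/-- This rests on `s (s Y - Y²) = Y (s - Y) Y + (s - Y) Y (s - Y)`. -/
theorem sq_le_smul {Y : Matrix (Fin n) (Fin n) ℝ} {s : ℝ} (hs : 0 ≤ s) (h0 : 0 ≤ Y)
    (h1 : Y ≤ s • 1) : Y * Y ≤ s • Y := by
  have hT := transpose_eq_of_nonneg h0
  have h2 := conj_nonneg (sub_nonneg.2 h1) Y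
  have h3 := conj_nonneg h0 (s • 1 - Y)
  have e : s • (s • Y - Y * Y) = Y * (s • 1 - Y) * Yᵀ + (s • 1 - Y) * Y * (s • 1 - Y)ᵀ := by
    simp only [Matrix.transpose_sub, Matrix.transpose_smul, Matrix.transpose_one, hT]
    simp only [mul_sub, sub_mul, smul_sub, Matrix.mul_smul, Matrix.smul_mul, mul_one, one_mul,
      mul_assoc]
    abel
  rcases hs.eq_or_lt with rfl | hs
  · have : Y = 0 := le_antisymm (by simpa using h1) h0
    simp [this]
  · rw [← sub_nonneg]
    have h4 : 0 ≤ s • (s • Y - Y * Y) := e ▸ add_nonneg h2 h3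
    have := smul_nonneg (inv_nonneg.2 hs.le) h4
    rwa [smul_smul, inv_mul_cancel₀ hs.ne', one_smul] at this

theorem le_norm_smul_one {X : Matrix (Fin n) (Fin n) ℝ} (hX : Xᵀ = X) : X ≤ ‖X‖ • 1 := by
  have hsa : IsSelfAdjoint X := by simpa [IsSelfAdjoint, Matrix.star_eq_conjTranspose] using hX
  rw [← Algebra.algebraMap_eq_smul_one]
  exact le_algebraMap_of_spectrum_le fun x hx =>
    (le_abs_self x).trans
      (IsometricContinuousFunctionalCalculus.norm_spectrum_le (𝕜 := ℝ) X hx hsa)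

theorem norm_le_of_le {X : Matrix (Fin n) (Fin n) ℝ} {s : ℝ} (hs : 0 ≤ s) (h0 : 0 ≤ X)
    (h1 : X ≤ s • 1) : ‖X‖ ≤ s := by
  have hsa : IsSelfAdjoint X := IsSelfAdjoint.of_nonneg h0
  rw [← Algebra.algebraMap_eq_smul_one] at h1
  rw [← cfc_id ℝ X]
  refine norm_cfc_le hs fun x hx => ?_
  rw [id, Real.norm_of_nonneg (spectrum_nonneg_of_nonneg h0 hx)]
  exact (le_algebraMap_iff_spectrum_le (R := ℝ)).1 h1 x hx

theorem norm_le_norm_of_le {X Y : Matrix (Fin n) (Fin n) ℝ} (h0 : 0 ≤ X) (h1 : X ≤ Y) :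
    ‖X‖ ≤ ‖Y‖ :=
  norm_le_of_le (norm_nonneg _) h0
    (h1.trans (le_norm_smul_one (transpose_eq_of_nonneg (h0.trans h1))))

theorem norm_transpose (X : Matrix (Fin n) (Fin m) ℝ) : ‖Xᵀ‖ = ‖X‖ := by
  simpa using Matrix.l2_opNorm_conjTranspose X

theorem nonneg_of_tendsto {S : ℕ → Matrix (Fin n) (Fin n) ℝ} {P : Matrix (Fin n) (Fin n) ℝ}
    (hS : ∀ t, 0 ≤ S t) (h : Tendsto S atTop (𝓝 P)) : 0 ≤ P := by
  rw [Matrix.nonneg_iff_posSemidef, Matrix.posSemidef_iff_dotProduct_mulVec]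
  constructor
  · have h2 : Tendsto (fun t => (S t)ᵀ) atTop (𝓝 Pᵀ) :=
      (continuous_id.matrix_transpose.tendsto P).comp h
    have := tendsto_nhds_unique h (h2.congr fun t => transpose_eq_of_nonneg (hS t))
    simpa [Matrix.IsHermitian] using this.symm
  · intro x
    have hc : Continuous fun M : Matrix (Fin n) (Fin n) ℝ => star x ⬝ᵥ M *ᵥ x := by fun_prop
    exact ge_of_tendsto' ((hc.tendsto P).comp h) fun t =>
      (Matrix.nonneg_iff_posSemidef.1 (hS t)).dotProduct_mulVec_nonneg x

theorem le_of_tendsto_of_forall_le {S T : ℕ → Matrix (Fin n) (Fin n) ℝ}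
    {P Q : Matrix (Fin n) (Fin n) ℝ} (hST : ∀ t, S t ≤ T t) (hS : Tendsto S atTop (𝓝 P))
    (hT : Tendsto T atTop (𝓝 Q)) : P ≤ Q :=
  sub_nonneg.1 (nonneg_of_tendsto (fun t => sub_nonneg.2 (hST t)) (hT.sub hS))

theorem tendsto_of_squeeze {L X Y : ℕ → Matrix (Fin n) (Fin n) ℝ} {P : Matrix (Fin n) (Fin n) ℝ}
    (hL : Tendsto L atTop (𝓝 P)) (hY : Tendsto Y atTop (𝓝 P)) (h1 : ∀ t, L t ≤ X t)
    (h2 : ∀ t, X t ≤ Y t) : Tendsto X atTop (𝓝 P) := by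
  have h3 : Tendsto (fun t => X t - L t) atTop (𝓝 0) := by
    refine squeeze_zero_norm (a := fun t => ‖Y t - L t‖) (fun t => ?_) ?_
    · exact norm_le_norm_of_le (sub_nonneg.2 (h1 t)) (sub_le_sub_right (h2 t) _)
    · simpa using (hY.sub hL).norm
  simpa using h3.add hL

/-- A monotone sequence of symmetric matrices that is bounded above converges: its quadratic
forms do, and the entries are recovered from these by polarisation. -/
theorem exists_tendsto_of_monotone {S : ℕ → Matrix (Fin n) (Fin n) ℝ}
    {M : Matrix (Fin n) (Fin n) ℝ} (h0 : ∀ t, 0 ≤ S t) (hS : Monotone S) (hM : ∀ t, S t ≤ M) :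
    ∃ P, Tendsto S atTop (𝓝 P) := by
  have hq : ∀ {X Y : Matrix (Fin n) (Fin n) ℝ}, X ≤ Y → ∀ x : Fin n → ℝ,
      x ⬝ᵥ X *ᵥ x ≤ x ⬝ᵥ Y *ᵥ x := fun {X Y} h x => by
    have := (Matrix.le_iff.1 h).dotProduct_mulVec_nonneg x
    simpa [Matrix.sub_mulVec] using this
  have hx : ∀ x : Fin n → ℝ, ∃ a, Tendsto (fun t => x ⬝ᵥ S t *ᵥ x) atTop (𝓝 a) := fun x =>
    ⟨_, tendsto_atTop_ciSup (fun _ _ hst => hq (hS hst) x)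
      ⟨x ⬝ᵥ M *ᵥ x, by rintro _ ⟨t, rfl⟩; exact hq (hM t) x⟩⟩
  choose q hq' using hx
  refine ⟨Matrix.of fun i j => (q (Pi.single i 1 + Pi.single j 1) - q (Pi.single i 1)
    - q (Pi.single j 1)) / 2, ?_⟩
  refine tendsto_pi_nhds.2 fun i => tendsto_pi_nhds.2 fun j => ?_
  refine ((((hq' (Pi.single i 1 + Pi.single j 1)).sub (hq' (Pi.single i 1))).sub
    (hq' (Pi.single j 1))).div_const 2).congr fun t => ?_
  have hsym : S t j i = S t i j := by
    conv_lhs => rw [← transpose_eq_of_nonneg (h0 t)]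
    rfl
  simp [Matrix.mulVec_add, add_dotProduct, hsym]
  ring

end Order

/-! ### The Riccati map -/

section Riccati
open scoped MatrixOrder

variable {n m p : ℕ} {A : Matrix (Fin n) (Fin n) ℝ} {B : Matrix (Fin n) (Fin m) ℝ}
  {C : Matrix (Fin p) (Fin n) ℝ} {D : Matrix (Fin p) (Fin m) ℝ} {X Y : Matrix (Fin n) (Fin n) ℝ}

/-- The Kalman gain `A X Cᵀ (C X Cᵀ + R)⁻¹` at the covariance `X`. -/
def gain (A : Matrix (Fin n) (Fin n) ℝ) (C : Matrix (Fin p) (Fin n) ℝ)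
    (D : Matrix (Fin p) (Fin m) ℝ) (X : Matrix (Fin n) (Fin n) ℝ) : Matrix (Fin n) (Fin p) ℝ :=
  A * X * Cᵀ * (C * X * Cᵀ + D * Dᵀ)⁻¹

/-- The closed-loop matrix `A - K C` for the Kalman gain `K` at the covariance `X`. -/
def closedLoop (A : Matrix (Fin n) (Fin n) ℝ) (C : Matrix (Fin p) (Fin n) ℝ)
    (D : Matrix (Fin p) (Fin m) ℝ) (X : Matrix (Fin n) (Fin n) ℝ) : Matrix (Fin n) (Fin n) ℝ :=
  A - gain A C D X * C

theorem posDef_innovation (hR : (D * Dᵀ).PosDef) (hX : 0 ≤ X) :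
    (C * X * Cᵀ + D * Dᵀ).PosDef :=
  hR.posSemidef_add (Matrix.nonneg_iff_posSemidef.1 (conj_nonneg hX C))

theorem gain_mul_innovation (hR : (D * Dᵀ).PosDef) (hX : 0 ≤ X) :
    gain A C D X * (C * X * Cᵀ + D * Dᵀ) = A * X * Cᵀ := by
  rw [gain, Matrix.nonsing_inv_mul_cancel_right]
  exact (Matrix.isUnit_iff_isUnit_det _).1 (posDef_innovation hR hX).isUnit

theorem closedLoop_mul (hR : (D * Dᵀ).PosDef) (hX : 0 ≤ X) :
    closedLoop A C D X * X * Cᵀ = gain A C D X * (D * Dᵀ) := by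
  have h := gain_mul_innovation (A := A) (C := C) hR hX
  rw [Matrix.mul_add, ← eq_sub_iff_add_eq'] at h
  rw [h, closedLoop]
  simp only [Matrix.sub_mul, Matrix.mul_assoc]

theorem riccati_eq_closedLoop :
    riccati A B C D X = closedLoop A C D X * X * Aᵀ + B * Bᵀ := by
  simp only [riccati, closedLoop, gain, Matrix.sub_mul, Matrix.mul_assoc]

/-- The mixed error covariance of the optimal filter and one with an arbitrary gain `K`: with
`K_X` the Kalman gain at `X`, only the noise term `K_X R Kᵀ` depends on `K`. -/
theorem closedLoop_mul_mul_transpose (hR : (D * Dᵀ).PosDef) (hX : 0 ≤ X)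
    (K : Matrix (Fin n) (Fin p) ℝ) :
    closedLoop A C D X * X * (A - K * C)ᵀ
      = riccati A B C D X - B * Bᵀ - gain A C D X * (D * Dᵀ) * Kᵀ := by
  rw [Matrix.transpose_sub, Matrix.mul_sub, Matrix.transpose_mul, ← Matrix.mul_assoc _ Cᵀ,
    closedLoop_mul hR hX, riccati_eq_closedLoop, add_sub_cancel_right]

theorem riccati_transpose (hX : 0 ≤ X) : (riccati A B C D X)ᵀ = riccati A B C D X := by
  simp only [riccati, Matrix.transpose_add, Matrix.transpose_sub, Matrix.transpose_mul,
    Matrix.transpose_transpose, transpose_eq_of_nonneg hX, Matrix.transpose_nonsing_inv,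
    Matrix.mul_assoc]

/-- An exact difference formula with no second-order remainder: the mixed noise term of the two
optimal filters cancels. -/
theorem riccati_sub (hR : (D * Dᵀ).PosDef) (hX : 0 ≤ X) (hY : 0 ≤ Y) :
    riccati A B C D X - riccati A B C D Y
      = closedLoop A C D X * (X - Y) * (closedLoop A C D Y)ᵀ := by
  have h1 : closedLoop A C D X * X * (closedLoop A C D Y)ᵀ = riccati A B C D X - B * Bᵀ
      - gain A C D X * (D * Dᵀ) * (gain A C D Y)ᵀ :=
    closedLoop_mul_mul_transpose hR hX (gain A C D Y)
  have h2 : closedLoop A C D Y * Y * (closedLoop A C D X)ᵀ = riccati A B C D Y - B * Bᵀ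
      - gain A C D Y * (D * Dᵀ) * (gain A C D X)ᵀ :=
    closedLoop_mul_mul_transpose hR hY (gain A C D X)
  have h3 := congrArg Matrix.transpose h2
  simp only [Matrix.transpose_sub, Matrix.transpose_mul, Matrix.transpose_transpose,
    riccati_transpose hY, transpose_eq_of_nonneg hY] at h3
  rw [Matrix.mul_sub, Matrix.sub_mul, h1, Matrix.mul_assoc _ Y, h3, Matrix.mul_assoc (gain A C D X)]
  abel

/-- Completion of the square: the Kalman gain minimises the error covariance. -/
theorem riccati_add_sq (hR : (D * Dᵀ).PosDef) (hX : 0 ≤ X) (K : Matrix (Fin n) (Fin p) ℝ) :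
    (A - K * C) * X * (A - K * C)ᵀ + K * (D * Dᵀ) * Kᵀ + B * Bᵀ
      = riccati A B C D X
        + (K - gain A C D X) * (C * X * Cᵀ + D * Dᵀ) * (K - gain A C D X)ᵀ := by
  have hg := gain_mul_innovation (A := A) (C := C) hR hX
  have hST : (C * X * Cᵀ + D * Dᵀ)ᵀ = C * X * Cᵀ + D * Dᵀ := by
    simp [Matrix.mul_assoc, transpose_eq_of_nonneg hX]
  have hg' := congrArg Matrix.transpose hg
  rw [Matrix.transpose_mul, hST] at hg'
  have hr : riccati A B C D X = A * X * Aᵀ - gain A C D X * (C * X * Aᵀ) + B * Bᵀ := by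
    simp only [riccati, gain, Matrix.mul_assoc]
  have hexp : ∀ (G : Matrix (Fin n) (Fin p) ℝ) (S : Matrix (Fin p) (Fin p) ℝ),
      (K - G) * S * (K - G)ᵀ = K * S * Kᵀ - K * (S * Gᵀ) - G * S * Kᵀ + G * S * Gᵀ := by
    intro G S
    simp only [Matrix.transpose_sub, Matrix.mul_sub, Matrix.sub_mul, Matrix.mul_assoc]
    abel
  rw [hr, hexp, hg, hg']
  have hg2 : A * X * Cᵀ * (gain A C D X)ᵀ = gain A C D X * (C * X * Aᵀ) := by
    rw [← hg, Matrix.mul_assoc, hg']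
    simp [Matrix.mul_assoc, transpose_eq_of_nonneg hX]
  rw [hg2]
  simp only [Matrix.transpose_sub, Matrix.transpose_mul, Matrix.transpose_transpose, Matrix.mul_sub,
    Matrix.sub_mul, Matrix.mul_add, Matrix.add_mul, Matrix.mul_assoc, transpose_eq_of_nonneg hX]
  abel

theorem riccati_le (hR : (D * Dᵀ).PosDef) (hX : 0 ≤ X) (K : Matrix (Fin n) (Fin p) ℝ) :
    riccati A B C D X ≤ (A - K * C) * X * (A - K * C)ᵀ + K * (D * Dᵀ) * Kᵀ + B * Bᵀ := by
  rw [riccati_add_sq hR hX K]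
  exact le_add_of_nonneg_right (conj_nonneg (posDef_innovation hR hX).posSemidef.nonneg _)

theorem riccati_eq (hR : (D * Dᵀ).PosDef) (hX : 0 ≤ X) :
    riccati A B C D X = closedLoop A C D X * X * (closedLoop A C D X)ᵀ
      + gain A C D X * (D * Dᵀ) * (gain A C D X)ᵀ + B * Bᵀ := by
  rw [closedLoop, riccati_add_sq hR hX]
  simp

theorem riccati_mono (hR : (D * Dᵀ).PosDef) (hX : 0 ≤ X) (hXY : X ≤ Y) :
    riccati A B C D X ≤ riccati A B C D Y := by
  rw [riccati_eq hR (hX.trans hXY)]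
  refine (riccati_le hR hX (gain A C D Y)).trans ?_
  gcongr
  exact conj_mono hXY _

theorem le_riccati (hR : (D * Dᵀ).PosDef) (hX : 0 ≤ X) : B * Bᵀ ≤ riccati A B C D X := by
  rw [riccati_eq hR hX]
  exact le_add_of_nonneg_left
    (add_nonneg (conj_nonneg hX _) (conj_nonneg hR.posSemidef.nonneg _))

theorem riccati_nonneg (hR : (D * Dᵀ).PosDef) (hX : 0 ≤ X) : 0 ≤ riccati A B C D X :=
  (mul_transpose_self_nonneg B).trans (le_riccati hR hX)

theorem riccati_smul_le (hR : (D * Dᵀ).PosDef) (hX : 0 ≤ X) {a : ℝ} (ha : 1 ≤ a) :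
    riccati A B C D (a • X) ≤ a • riccati A B C D X := by
  have ha0 : 0 ≤ a := zero_le_one.trans ha
  have hle : ∀ {Z : Matrix (Fin n) (Fin n) ℝ}, 0 ≤ Z → Z ≤ a • Z := fun {Z} hZ => by
    rw [← sub_nonneg, show a • Z - Z = (a - 1) • Z by rw [sub_smul, one_smul]]
    exact smul_nonneg (sub_nonneg.2 ha) hZ
  refine (riccati_le hR (smul_nonneg ha0 hX) (gain A C D X)).trans ?_
  rw [riccati_eq hR hX, smul_add, smul_add, Matrix.mul_smul, Matrix.smul_mul]
  exact add_le_add (add_le_add le_rfl (hle (conj_nonneg hR.posSemidef.nonneg _)))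
    (hle (mul_transpose_self_nonneg B))

theorem iterate_riccati_nonneg (hR : (D * Dᵀ).PosDef) (hX : 0 ≤ X) (t : ℕ) :
    0 ≤ (riccati A B C D)^[t] X := by
  induction t with
  | zero => exact hX
  | succ t ih => rw [Function.iterate_succ_apply']; exact riccati_nonneg hR ih

theorem iterate_riccati_mono (hR : (D * Dᵀ).PosDef) (hX : 0 ≤ X) (hXY : X ≤ Y) (t : ℕ) :
    (riccati A B C D)^[t] X ≤ (riccati A B C D)^[t] Y := by
  induction t with
  | zero => exact hXY
  | succ t ih =>
    rw [Function.iterate_succ_apply', Function.iterate_succ_apply']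
    exact riccati_mono hR (iterate_riccati_nonneg hR hX t) ih

theorem monotone_iterate_riccati_zero (hR : (D * Dᵀ).PosDef) :
    Monotone fun t : ℕ => (riccati A B C D)^[t] 0 := by
  refine monotone_nat_of_le_succ fun t => ?_
  rw [Function.iterate_succ_apply]
  exact iterate_riccati_mono hR le_rfl (riccati_nonneg hR le_rfl) t

theorem continuousAt_closedLoop (hR : (D * Dᵀ).PosDef) (hX : 0 ≤ X) :
    ContinuousAt (closedLoop A C D) X := by
  have hc : Continuous fun X : Matrix (Fin n) (Fin n) ℝ => C * X * Cᵀ + D * Dᵀ := by fun_prop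
  have hdet := (posDef_innovation (C := C) hR hX).det_pos.ne'
  have hi : ContinuousAt (fun X : Matrix (Fin n) (Fin n) ℝ => (C * X * Cᵀ + D * Dᵀ)⁻¹) X := by
    refine ContinuousAt.comp (f := fun X : Matrix (Fin n) (Fin n) ℝ => C * X * Cᵀ + D * Dᵀ)
      (g := fun M : Matrix (Fin p) (Fin p) ℝ => M⁻¹) (continuousAt_matrix_inv _ ?_)
      hc.continuousAt
    simpa [Ring.inverse_eq_inv'] using continuousAt_inv₀ hdet
  have h1 : Continuous fun q : Matrix (Fin n) (Fin n) ℝ × Matrix (Fin p) (Fin p) ℝ =>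
      A - A * q.1 * Cᵀ * q.2 * C := by fun_prop
  exact ContinuousAt.comp (f := fun X : Matrix (Fin n) (Fin n) ℝ =>
    (X, (C * X * Cᵀ + D * Dᵀ)⁻¹)) h1.continuousAt (continuousAt_id.prodMk hi)

end Riccati

/-! ### The classical iteration -/

section Classical
open scoped MatrixOrder

variable {n m p : ℕ} {A : Matrix (Fin n) (Fin n) ℝ} {B : Matrix (Fin n) (Fin m) ℝ}
  {C : Matrix (Fin p) (Fin n) ℝ} {D : Matrix (Fin p) (Fin m) ℝ} {X Y : Matrix (Fin n) (Fin n) ℝ}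

open scoped Matrix.Norms.L2Operator in
/-- By Gelfand's formula, the powers of a matrix whose complex eigenvalues lie in the open unit
disc tend to `0`. -/
theorem tendsto_pow_zero_of_spectrum {M : Matrix (Fin n) (Fin n) ℝ}
    (h : ∀ z ∈ spectrum ℂ (M.map (algebraMap ℝ ℂ)), ‖z‖ < 1) :
    Tendsto (fun k : ℕ => M ^ k) atTop (𝓝 0) := by
  rcases subsingleton_or_nontrivial (Matrix (Fin n) (Fin n) ℂ) with hs | hs
  · have : ∀ M : Matrix (Fin n) (Fin n) ℝ, M = 0 := fun M => by
      have h1 := hs.elim (M.map (algebraMap ℝ ℂ)) 0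
      ext i j
      simpa using congrFun (congrFun h1 i) j
    simp [this]
  set a : Matrix (Fin n) (Fin n) ℂ := M.map (algebraMap ℝ ℂ) with ha
  have h1 : spectralRadius ℂ a < ((1 : NNReal) : ENNReal) :=
    spectrum.spectralRadius_lt_of_forall_lt a fun z hz => by
      have := h z hz
      rw [← NNReal.coe_lt_coe]; simpa using this
  obtain ⟨r, hr1, hr2⟩ := ENNReal.lt_iff_exists_nnreal_btwn.1 h1
  have h2 : Tendsto (fun k : ℕ => a ^ k) atTop (𝓝 0) := by
    refine squeeze_zero_norm' (a := fun k => (r : ℝ) ^ k) ?_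
      (tendsto_pow_atTop_nhds_zero_of_lt_one r.2 (by exact_mod_cast hr2))
    filter_upwards [(spectrum.pow_nnnorm_pow_one_div_tendsto_nhds_spectralRadius a).eventually
      (gt_mem_nhds hr1), eventually_gt_atTop 0] with k hk hk0
    have h3 := ENNReal.rpow_le_rpow hk.le (Nat.cast_nonneg (α := ℝ) k)
    rw [← ENNReal.rpow_mul, one_div_mul_cancel (by positivity), ENNReal.rpow_one,
      ENNReal.rpow_natCast] at h3
    exact_mod_cast h3
  have h3 : ∀ k, M ^ k = (a ^ k).map Complex.re := fun k => by
    rw [ha, ← Matrix.map_pow]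
    ext i j
    simp
  have h4 : Continuous fun N : Matrix (Fin n) (Fin n) ℂ => N.map Complex.re :=
    continuous_id.matrix_map Complex.continuous_re
  simpa [← h3, Function.comp_def] using (h4.tendsto 0).comp h2

/-- The reachable states whose first `t` free outputs vanish. -/
def unobservable (A : Matrix (Fin n) (Fin n) ℝ) (B : Matrix (Fin n) (Fin m) ℝ)
    (C : Matrix (Fin p) (Fin n) ℝ) (t : ℕ) : Submodule ℝ (Fin n → ℝ) :=
  reachableSubspace A B ⊓ ⨅ k : Fin t, LinearMap.ker (C * A ^ (k : ℕ)).mulVecLin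

theorem mem_unobservable {t : ℕ} {x : Fin n → ℝ} : x ∈ unobservable A B C t ↔
    x ∈ reachableSubspace A B ∧ ∀ k < t, (C * A ^ k) *ᵥ x = 0 := by
  simp [unobservable, Fin.forall_iff]

theorem exists_unobservable_eq_bot (hobs : ReachableSubsystemObservable A B C) :
    ∃ N, unobservable A B C N = ⊥ := by
  have hanti : ∀ s t, s ≤ t → unobservable A B C t ≤ unobservable A B C s := fun s t hst x hx =>
    mem_unobservable.2 ⟨(mem_unobservable.1 hx).1,
      fun k hk => (mem_unobservable.1 hx).2 k (hk.trans_le hst)⟩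
  obtain ⟨N, hN⟩ := IsArtinian.monotone_stabilizes
    (⟨fun t => OrderDual.toDual (unobservable A B C t), hanti⟩ : ℕ →o (Submodule ℝ (Fin n → ℝ))ᵒᵈ)
  have hN' : ∀ t, N ≤ t → unobservable A B C N = unobservable A B C t := hN
  refine ⟨N, (Submodule.eq_bot_iff _).2 fun x hx =>
    hobs x (mem_unobservable.1 hx).1 fun k => ?_⟩
  rw [hN' (max N (k + 1)) (le_max_left _ _)] at hx
  exact (mem_unobservable.1 hx).2 k (lt_of_lt_of_le (Nat.lt_succ_self k) (le_max_right _ _))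

/-- One step of a dead-beat observer: an output injection `K` after which the error started in a
state with `t` vanishing outputs looks as if it had been started in one with `t + 1` of them. -/
theorem exists_deadbeat_gain (A : Matrix (Fin n) (Fin n) ℝ) (B : Matrix (Fin n) (Fin m) ℝ)
    (C : Matrix (Fin p) (Fin n) ℝ) (t : ℕ) : ∃ K : Matrix (Fin n) (Fin p) ℝ,
    ∀ y ∈ unobservable A B C t, ∃ y' ∈ unobservable A B C (t + 1),
      (A - K * C) *ᵥ (A ^ t *ᵥ y) = A ^ (t + 1) *ᵥ y' := by
  set f : unobservable A B C t →ₗ[ℝ] (Fin p → ℝ) :=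
    (C * A ^ t).mulVecLin ∘ₗ (unobservable A B C t).subtype with hf
  obtain ⟨g, hg⟩ := LinearMap.exists_rightInverse_of_surjective f.rangeRestrict
    f.range_rangeRestrict
  obtain ⟨s, hs⟩ := LinearMap.exists_extend g
  have hfs : ∀ y, f (s (f y)) = f y := fun y => by
    have h1 : s (f y) = g (f.rangeRestrict y) := by
      rw [← hs]; rfl
    rw [h1]
    exact congrArg Subtype.val (LinearMap.congr_fun hg (f.rangeRestrict y))
  set k := (A ^ (t + 1)).mulVecLin ∘ₗ (unobservable A B C t).subtype ∘ₗ s with hk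
  refine ⟨LinearMap.toMatrix' k, fun y hy => ⟨y - s (f ⟨y, hy⟩), ?_, ?_⟩⟩
  · have hmem := (unobservable A B C t).sub_mem hy (s (f ⟨y, hy⟩)).2
    refine mem_unobservable.2 ⟨(mem_unobservable.1 hmem).1, fun i hi => ?_⟩
    rcases Nat.lt_succ_iff_lt_or_eq.1 hi with hi | rfl
    · exact (mem_unobservable.1 hmem).2 i hi
    · rw [Matrix.mulVec_sub, sub_eq_zero]
      exact (hfs ⟨y, hy⟩).symm
  · rw [Matrix.sub_mulVec, ← Matrix.mulVec_mulVec, LinearMap.toMatrix'_mulVec, Matrix.mulVec_sub,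
      Matrix.mulVec_mulVec, ← pow_succ', Matrix.mulVec_mulVec]
    rfl

/-- Running the dead-beat observer for `t` steps bounds the Riccati iterates. -/
theorem exists_iterate_riccati_le (hR : (D * Dᵀ).PosDef) (t : ℕ) :
    ∃ Φ M : Matrix (Fin n) (Fin n) ℝ,
      (∀ x ∈ reachableSubspace A B, ∃ y ∈ unobservable A B C t, Φ *ᵥ x = A ^ t *ᵥ y) ∧
      ∀ X, 0 ≤ X → (riccati A B C D)^[t] X ≤ Φ * X * Φᵀ + M := by
  induction t with
  | zero =>
    refine ⟨1, 0, fun x hx => ⟨x, mem_unobservable.2 ⟨hx, by simp⟩, by simp⟩, by simp⟩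
  | succ t ih =>
    obtain ⟨Φ, M, h1, h2⟩ := ih
    obtain ⟨K, hK⟩ := exists_deadbeat_gain A B C t
    refine ⟨(A - K * C) * Φ, (A - K * C) * M * (A - K * C)ᵀ + K * (D * Dᵀ) * Kᵀ + B * Bᵀ,
      fun x hx => ?_, fun X hX => ?_⟩
    · obtain ⟨y, hy, hxy⟩ := h1 x hx
      obtain ⟨y', hy', h⟩ := hK y hy
      exact ⟨y', hy', by rw [← Matrix.mulVec_mulVec, hxy, h]⟩
    · rw [Function.iterate_succ_apply']
      have h0 := iterate_riccati_nonneg (A := A) (B := B) (C := C) hR hX t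
      refine (riccati_mono hR h0 (h2 X hX)).trans
        ((riccati_le hR (h0.trans (h2 X hX)) K).trans (le_of_eq ?_))
      simp only [Matrix.mul_add, Matrix.add_mul, Matrix.transpose_mul, Matrix.mul_assoc]
      abel

/-- Observability bounds the iterates after finitely many steps, whatever the initial covariance
on the reachable subspace is. -/
theorem exists_uniform_bound (hR : (D * Dᵀ).PosDef) (hobs : ReachableSubsystemObservable A B C) :
    ∃ (N : ℕ) (M : Matrix (Fin n) (Fin n) ℝ), ∀ X, 0 ≤ X → im X ≤ reachableSubspace A B →
      (riccati A B C D)^[N] X ≤ M := by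
  obtain ⟨N, hN⟩ := exists_unobservable_eq_bot hobs
  obtain ⟨Φ, M, h1, h2⟩ := exists_iterate_riccati_le (A := A) (B := B) (C := C) hR N
  refine ⟨N, M, fun X hX hV => ?_⟩
  have h3 : Φ * X = 0 := by
    refine Matrix.ext_of_mulVec_single fun i => ?_
    obtain ⟨y, hy, h⟩ := h1 (X *ᵥ Pi.single i 1) (hV ⟨_, rfl⟩)
    rw [hN, Submodule.mem_bot] at hy
    rw [← Matrix.mulVec_mulVec, h, hy, Matrix.mulVec_zero, Matrix.zero_mulVec]
  simpa [h3] using h2 X hX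

theorem im_mul_le {k : ℕ} (M : Matrix (Fin n) (Fin k) ℝ) {l : ℕ} (N : Matrix (Fin k) (Fin l) ℝ) :
    im (M * N) ≤ im M := by
  rintro _ ⟨x, rfl⟩
  exact ⟨N *ᵥ x, by simp⟩

theorem mulVec_mem_reachableSubspace {x : Fin n → ℝ} (hx : x ∈ reachableSubspace A B) :
    A *ᵥ x ∈ reachableSubspace A B := by
  have h : reachableSubspace A B ≤ (reachableSubspace A B).comap A.mulVecLin := by
    refine iSup_le fun k => ?_
    rintro _ ⟨y, rfl⟩
    refine (le_iSup (fun k => im (A ^ k * B)) (k + 1)) ⟨y, ?_⟩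
    simp [pow_succ', Matrix.mul_assoc]
  exact h hx

theorem im_riccati_le_reachableSubspace (hX : im X ≤ reachableSubspace A B) :
    im (riccati A B C D X) ≤ reachableSubspace A B := by
  rintro _ ⟨x, rfl⟩
  have hr : riccati A B C D X = A * (X * (Aᵀ - Cᵀ * ((C * X * Cᵀ + D * Dᵀ)⁻¹ * (C * (X * Aᵀ)))))
      + B * Bᵀ := by
    simp only [riccati, Matrix.mul_sub, Matrix.mul_assoc]
  rw [hr, Matrix.mulVecLin_apply, Matrix.add_mulVec]
  refine Submodule.add_mem _ ?_ ?_
  · rw [← Matrix.mulVec_mulVec]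
    exact mulVec_mem_reachableSubspace (hX (im_mul_le _ _ ⟨x, rfl⟩))
  · refine (le_iSup (fun k => im (A ^ k * B)) 0) ?_
    rw [pow_zero, Matrix.one_mul]
    exact im_mul_le _ _ ⟨x, rfl⟩

theorem im_iterate_riccati_zero_le (t : ℕ) :
    im ((riccati A B C D)^[t] 0) ≤ reachableSubspace A B := by
  induction t with
  | zero => rintro _ ⟨x, rfl⟩; simp
  | succ t ih => rw [Function.iterate_succ_apply']; exact im_riccati_le_reachableSubspace ih

/-- The iteration from `0` increases to a positive semidefinite fixed point. -/
theorem exists_tendsto_iterate_zero (hR : (D * Dᵀ).PosDef)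
    (hobs : ReachableSubsystemObservable A B C) :
    ∃ P, 0 ≤ P ∧ riccati A B C D P = P ∧ im P ≤ reachableSubspace A B ∧
      Tendsto (fun t : ℕ => (riccati A B C D)^[t] 0) atTop (𝓝 P) := by
  obtain ⟨N, M, hM⟩ := exists_uniform_bound (A := A) (B := B) (C := C) hR hobs
  have h0 : ∀ t, 0 ≤ (riccati A B C D)^[t] 0 := iterate_riccati_nonneg hR le_rfl
  have hmono := monotone_iterate_riccati_zero (A := A) (B := B) (C := C) hR
  have hle : ∀ t, (riccati A B C D)^[t] 0 ≤ M := fun t =>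
    (hmono (Nat.le_add_left t N)).trans (by
      simpa only [Function.iterate_add_apply] using hM _ (h0 t) (im_iterate_riccati_zero_le t))
  obtain ⟨P, hP⟩ := exists_tendsto_of_monotone h0 hmono hle
  have hP0 := nonneg_of_tendsto h0 hP
  refine ⟨P, hP0, ?_, ?_, hP⟩
  · have hc : ContinuousAt (riccati A B C D) P := by
      have h1 : ContinuousAt (fun X => closedLoop A C D X * X * Aᵀ + B * Bᵀ) P :=
        (((continuousAt_closedLoop hR hP0).mul continuousAt_id).mul continuousAt_const).add
          continuousAt_const
      exact h1.congr (Eventually.of_forall fun X => riccati_eq_closedLoop.symm)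
    refine tendsto_nhds_unique ?_ ((tendsto_add_atTop_iff_nat 1).2 hP)
    simp only [Function.iterate_succ_apply']
    exact hc.tendsto.comp hP
  · rintro _ ⟨x, rfl⟩
    have hc : Continuous fun M : Matrix (Fin n) (Fin n) ℝ => M *ᵥ x := by fun_prop
    exact (Submodule.closed_of_finiteDimensional _).mem_of_tendsto ((hc.tendsto P).comp hP)
      (Eventually.of_forall fun t => im_iterate_riccati_zero_le t ⟨x, rfl⟩)

theorem exists_vecMul_eq_smul {M : Matrix (Fin n) (Fin n) ℂ} {z : ℂ} :
    z ∈ spectrum ℂ M ↔ ∃ v, v ≠ 0 ∧ v ᵥ* M = z • v := by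
  rw [spectrum.mem_iff, Matrix.isUnit_iff_isUnit_det, isUnit_iff_ne_zero, not_not,
    ← Matrix.exists_vecMul_eq_zero_iff]
  refine exists_congr fun v => and_congr_right fun _ => ?_
  rw [Matrix.vecMul_sub, sub_eq_zero, Algebra.algebraMap_eq_smul_one, Matrix.vecMul_smul,
    Matrix.vecMul_one, eq_comm]

theorem vecMul_self_transpose_dotProduct {k : ℕ} (M : Matrix (Fin n) (Fin k) ℝ) (v : Fin n → ℂ) :
    v ᵥ* ((M * Mᵀ).map (algebraMap ℝ ℂ)) ⬝ᵥ star v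
      = ((∑ i, ‖(v ᵥ* M.map (algebraMap ℝ ℂ)) i‖ ^ 2 : ℝ) : ℂ) := by
  have h1 : (Mᵀ).map (algebraMap ℝ ℂ) = (M.map (algebraMap ℝ ℂ))ᴴ := by
    ext i j; simp
  rw [Matrix.map_mul, h1, ← Matrix.vecMul_vecMul, ← Matrix.dotProduct_mulVec,
    ← Matrix.star_vecMul]
  simp [dotProduct, Complex.mul_conj, Complex.normSq_eq_norm_sq]

/-- Evaluate a Lyapunov equation at a left eigenvector whose eigenvalue has modulus at least `1`:
the source terms vanish there. -/
theorem vecMul_eq_zero_of_lyapunov {k : ℕ} {S L : Matrix (Fin n) (Fin n) ℝ}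
    {G : Matrix (Fin n) (Fin k) ℝ} (h : S * Sᵀ = (L * S) * (L * S)ᵀ + G * Gᵀ + B * Bᵀ) {z : ℂ}
    {v : Fin n → ℂ} (hv : v ᵥ* L.map (algebraMap ℝ ℂ) = z • v) (hz : 1 ≤ ‖z‖) :
    v ᵥ* G.map (algebraMap ℝ ℂ) = 0 ∧ v ᵥ* B.map (algebraMap ℝ ℂ) = 0 := by
  have hadd : ∀ M N : Matrix (Fin n) (Fin n) ℝ, (M + N).map (algebraMap ℝ ℂ)
      = M.map (algebraMap ℝ ℂ) + N.map (algebraMap ℝ ℂ) := fun M N =>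
    Matrix.map_add _ (map_add (algebraMap ℝ ℂ)) M N
  have h3 : v ᵥ* (L * S).map (algebraMap ℝ ℂ) = z • (v ᵥ* S.map (algebraMap ℝ ℂ)) := by
    rw [Matrix.map_mul, ← Matrix.vecMul_vecMul, hv, Matrix.smul_vecMul]
  have h2 : v ᵥ* ((S * Sᵀ).map (algebraMap ℝ ℂ)) ⬝ᵥ star v
      = v ᵥ* (((L * S) * (L * S)ᵀ + G * Gᵀ + B * Bᵀ).map (algebraMap ℝ ℂ)) ⬝ᵥ star v := by
    rw [h]
  rw [hadd, hadd, Matrix.vecMul_add, Matrix.vecMul_add, add_dotProduct, add_dotProduct,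
    vecMul_self_transpose_dotProduct, vecMul_self_transpose_dotProduct,
    vecMul_self_transpose_dotProduct, vecMul_self_transpose_dotProduct, h3,
    ← Complex.ofReal_add, ← Complex.ofReal_add, Complex.ofReal_inj] at h2
  simp only [Pi.smul_apply, norm_smul, mul_pow, ← Finset.mul_sum] at h2
  have hs0 : 0 ≤ ∑ i, ‖(v ᵥ* S.map (algebraMap ℝ ℂ)) i‖ ^ 2 := by positivity
  have hs1 := le_mul_of_one_le_left hs0 (one_le_pow₀ (n := 2) hz)
  have hzero : ∀ {k : ℕ} (u : Fin k → ℂ), ∑ i, ‖u i‖ ^ 2 ≤ 0 → u = 0 := fun u hu => by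
    have := (Finset.sum_eq_zero_iff_of_nonneg fun i _ => by positivity).1
      (le_antisymm hu (by positivity))
    ext i
    simpa using this i (Finset.mem_univ i)
  have hn1 : 0 ≤ ∑ i, ‖(v ᵥ* G.map (algebraMap ℝ ℂ)) i‖ ^ 2 := by positivity
  have hn2 : 0 ≤ ∑ i, ‖(v ᵥ* B.map (algebraMap ℝ ℂ)) i‖ ^ 2 := by positivity
  exact ⟨hzero _ (by linarith), hzero _ (by linarith)⟩

theorem exists_eq_mul_transpose {P : Matrix (Fin n) (Fin n) ℝ} (hP : 0 ≤ P) :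
    ∃ S : Matrix (Fin n) (Fin n) ℝ, P = S * Sᵀ := by
  obtain ⟨T, hT⟩ := CStarAlgebra.nonneg_iff_eq_mul_star_self.1 hP
  exact ⟨T, by simpa [Matrix.star_eq_conjTranspose] using hT⟩

/-- A left eigenvector of the closed loop for an eigenvalue `z` with `1 ≤ |z|` is annihilated
by the gain and by `B`, so that `z` is an eigenvalue of `A + B K` for every feedback `K`. -/
theorem tendsto_pow_closedLoop (hR : (D * Dᵀ).PosDef) (hstab : Stabilizable A B)
    {P : Matrix (Fin n) (Fin n) ℝ} (hP : 0 ≤ P) (hfix : riccati A B C D P = P) :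
    Tendsto (fun k : ℕ => closedLoop A C D P ^ k) atTop (𝓝 0) := by
  refine tendsto_pow_zero_of_spectrum fun z hz => ?_
  by_contra! hz1
  obtain ⟨v, hv, hvz⟩ := exists_vecMul_eq_smul.1 hz
  obtain ⟨K₀, hK₀⟩ := hstab
  refine (hK₀ z (exists_vecMul_eq_smul.2 ⟨v, hv, ?_⟩)).not_ge hz1
  obtain ⟨S, hS⟩ := exists_eq_mul_transpose hP
  have heq : S * Sᵀ = (closedLoop A C D P * S) * (closedLoop A C D P * S)ᵀ
      + (gain A C D P * D) * (gain A C D P * D)ᵀ + B * Bᵀ := by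
    have h := riccati_eq (A := A) (B := B) (C := C) hR hP
    rw [hfix] at h
    calc S * Sᵀ = closedLoop A C D P * P * (closedLoop A C D P)ᵀ
          + gain A C D P * (D * Dᵀ) * (gain A C D P)ᵀ + B * Bᵀ := by rw [← hS, ← h]
      _ = closedLoop A C D P * (S * Sᵀ) * (closedLoop A C D P)ᵀ
          + gain A C D P * (D * Dᵀ) * (gain A C D P)ᵀ + B * Bᵀ := by rw [← hS]
      _ = _ := by simp only [Matrix.transpose_mul, Matrix.mul_assoc]
  obtain ⟨hKD, hB⟩ := vecMul_eq_zero_of_lyapunov heq hvz hz1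
  have h5 : A + B * K₀ = closedLoop A C D P
      + (gain A C D P * D) * (Dᵀ * (D * Dᵀ)⁻¹) * C + B * K₀ := by
    rw [Matrix.mul_assoc (gain A C D P), ← Matrix.mul_assoc D, Matrix.mul_nonsing_inv,
      Matrix.mul_one, closedLoop, sub_add_cancel]
    exact (Matrix.isUnit_iff_isUnit_det _).1 hR.isUnit
  rw [h5]
  generalize gain A C D P * D = G at hKD
  generalize Dᵀ * (D * Dᵀ)⁻¹ = E
  rw [Matrix.map_add _ (map_add (algebraMap ℝ ℂ)), Matrix.map_add _ (map_add (algebraMap ℝ ℂ)),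
    Matrix.map_mul, Matrix.map_mul, Matrix.map_mul, Matrix.vecMul_add, Matrix.vecMul_add,
    ← Matrix.vecMul_vecMul, ← Matrix.vecMul_vecMul, ← Matrix.vecMul_vecMul, hKD, hB, hvz]
  simp

theorem iterate_riccati_sub_le (hR : (D * Dᵀ).PosDef) {P : Matrix (Fin n) (Fin n) ℝ} (hP : 0 ≤ P)
    (hfix : riccati A B C D P = P) (hX : 0 ≤ X) (t : ℕ) :
    (riccati A B C D)^[t] X ≤ P + closedLoop A C D P ^ t * (X - P) * (closedLoop A C D P ^ t)ᵀ := by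
  induction t with
  | zero => simp
  | succ t ih =>
    have h0 := iterate_riccati_nonneg (A := A) (B := B) (C := C) hR hX t
    rw [Function.iterate_succ_apply']
    refine (riccati_mono hR h0 ih).trans ((riccati_le hR (h0.trans ih) (gain A C D P)).trans
      (le_of_eq ?_))
    have h1 := riccati_eq (A := A) (B := B) (C := C) hR hP
    rw [hfix] at h1
    rw [← closedLoop]
    generalize closedLoop A C D P = L at *
    calc L * (P + L ^ t * (X - P) * (L ^ t)ᵀ) * Lᵀ
          + gain A C D P * (D * Dᵀ) * (gain A C D P)ᵀ + B * Bᵀ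
        = (L * P * Lᵀ + gain A C D P * (D * Dᵀ) * (gain A C D P)ᵀ + B * Bᵀ)
          + L ^ (t + 1) * (X - P) * (L ^ (t + 1))ᵀ := by
          rw [pow_succ' L t]
          simp only [Matrix.mul_add, Matrix.add_mul, Matrix.transpose_mul, Matrix.mul_assoc]
          abel
      _ = _ := by rw [← h1]

theorem tendsto_iterate_riccati (hR : (D * Dᵀ).PosDef) (hstab : Stabilizable A B)
    {P : Matrix (Fin n) (Fin n) ℝ} (hP : 0 ≤ P) (hfix : riccati A B C D P = P)
    (hlim : Tendsto (fun t : ℕ => (riccati A B C D)^[t] 0) atTop (𝓝 P)) (hX : 0 ≤ X) :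
    Tendsto (fun t : ℕ => (riccati A B C D)^[t] X) atTop (𝓝 P) := by
  refine tendsto_of_squeeze hlim ?_ (fun t => iterate_riccati_mono hR le_rfl hX t)
    (fun t => iterate_riccati_sub_le hR hP hfix hX t)
  have hc : Continuous fun M : Matrix (Fin n) (Fin n) ℝ => P + M * (X - P) * Mᵀ := by fun_prop
  simpa [Function.comp_def] using (hc.tendsto 0).comp (tendsto_pow_closedLoop hR hstab hP hfix)

theorem exists_eq_mul_of_im_le {k l : ℕ} {M : Matrix (Fin n) (Fin k) ℝ}
    {N : Matrix (Fin n) (Fin l) ℝ} (h : im M ≤ im N) :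
    ∃ W : Matrix (Fin l) (Fin k) ℝ, M = N * W := by
  have h1 : ∀ i, ∃ w, N *ᵥ w = M *ᵥ Pi.single i 1 := fun i => h ⟨Pi.single i 1, rfl⟩
  choose w hw using h1
  refine ⟨(Matrix.of w)ᵀ, Matrix.ext_of_mulVec_single fun i => ?_⟩
  rw [← Matrix.mulVec_mulVec, ← hw, Matrix.mulVec_single_one]
  rfl

theorem proj_mul_of_im_le {l k : ℕ} {U : Matrix (Fin n) (Fin l) ℝ} (hU : Uᵀ * U = 1)
    {M : Matrix (Fin n) (Fin k) ℝ} (h : im M ≤ im U) : U * Uᵀ * M = M := by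
  obtain ⟨W, rfl⟩ := exists_eq_mul_of_im_le h
  rw [Matrix.mul_assoc, ← Matrix.mul_assoc Uᵀ, hU, Matrix.one_mul]

/-- The image of a fixed point of the Riccati map contains `im B` and is invariant under `A`:
sandwich the fixed-point equation between two copies of the projection onto the kernel. -/
theorem proj_mul_of_fixed (hR : (D * Dᵀ).PosDef) {P : Matrix (Fin n) (Fin n) ℝ} (hP : 0 ≤ P)
    (hfix : riccati A B C D P = P) {l : ℕ} {U : Matrix (Fin n) (Fin l) ℝ} (hU : Uᵀ * U = 1)
    (him : im U = im P) :
    U * Uᵀ * B = B ∧ U * Uᵀ * (A * (U * Uᵀ)) = A * (U * Uᵀ) := by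
  obtain ⟨S, hS⟩ := exists_eq_mul_transpose hP
  set E := 1 - U * Uᵀ with hE
  have hEP : E * P = 0 := by
    rw [hE, Matrix.sub_mul, Matrix.one_mul, proj_mul_of_im_le hU him.ge, sub_self]
  have heq : (E * (closedLoop A C D P * S)) * (E * (closedLoop A C D P * S))ᵀ
      + (E * (gain A C D P * D)) * (E * (gain A C D P * D))ᵀ + (E * B) * (E * B)ᵀ = 0 := by
    have h := riccati_eq (A := A) (B := B) (C := C) hR hP
    rw [hfix] at h
    calc _ = E * (closedLoop A C D P * (S * Sᵀ) * (closedLoop A C D P)ᵀ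
          + gain A C D P * (D * Dᵀ) * (gain A C D P)ᵀ + B * Bᵀ) * Eᵀ := by
          simp only [Matrix.transpose_mul, Matrix.mul_add, Matrix.add_mul, Matrix.mul_assoc]
      _ = E * P * Eᵀ := by rw [← hS, ← h]
      _ = 0 := by rw [hEP, Matrix.zero_mul]
  have hz : ∀ {k : ℕ} (M : Matrix (Fin n) (Fin k) ℝ), M * Mᵀ = 0 → M = 0 := fun M h => by
    rw [← Matrix.conjTranspose_eq_transpose_of_trivial] at h
    exact Matrix.self_mul_conjTranspose_eq_zero.1 h
  have h1 := mul_transpose_self_nonneg (E * (closedLoop A C D P * S))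
  have h2 := mul_transpose_self_nonneg (E * (gain A C D P * D))
  have h3 := mul_transpose_self_nonneg (E * B)
  obtain ⟨h12, hB⟩ := (add_eq_zero_iff_of_nonneg (add_nonneg h1 h2) h3).1 heq
  obtain ⟨hL, hG⟩ := (add_eq_zero_iff_of_nonneg h1 h2).1 h12
  have hB' := hz _ hB
  have hL' := hz _ hL
  have hG' := hz _ hG
  have hK : E * gain A C D P = 0 := by
    have h4 : E * gain A C D P = E * (gain A C D P * D) * (Dᵀ * (D * Dᵀ)⁻¹) := by
      rw [Matrix.mul_assoc, Matrix.mul_assoc (gain A C D P), ← Matrix.mul_assoc D,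
        Matrix.mul_nonsing_inv, Matrix.mul_one]
      exact (Matrix.isUnit_iff_isUnit_det _).1 hR.isUnit
    rw [h4, hG', Matrix.zero_mul]
  have hA : E * A * P = 0 := by
    have h5 : A = closedLoop A C D P + gain A C D P * C := by rw [closedLoop, sub_add_cancel]
    have h6 : E * (closedLoop A C D P * P) = E * (closedLoop A C D P * S) * Sᵀ := by
      rw [Matrix.mul_assoc, Matrix.mul_assoc _ S, ← hS]
    have h7 : E * A * P = E * (closedLoop A C D P * P) + E * gain A C D P * (C * P) := by
      conv_lhs => rw [h5]
      simp only [Matrix.mul_add, Matrix.add_mul, Matrix.mul_assoc]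
    rw [h7, h6, hL', hK, Matrix.zero_mul, Matrix.zero_mul, add_zero]
  obtain ⟨W, hW⟩ := exists_eq_mul_of_im_le him.le
  constructor
  · rwa [hE, Matrix.sub_mul, Matrix.one_mul, sub_eq_zero, eq_comm] at hB'
  · have h7 : E * (A * (U * Uᵀ)) = 0 := by
      calc E * (A * (U * Uᵀ)) = E * A * (P * W) * Uᵀ := by
            rw [← hW]; simp only [Matrix.mul_assoc]
        _ = 0 := by rw [← Matrix.mul_assoc, hA, Matrix.zero_mul, Matrix.zero_mul]
    rwa [hE, Matrix.sub_mul, Matrix.one_mul, sub_eq_zero, eq_comm] at h7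

open scoped Matrix.Norms.L2Operator in
/-- With `U = P W`, the projection `U Uᵀ = P W Wᵀ P` is at most a multiple of `P²`, hence of
`P`. -/
theorem exists_proj_le_smul {P : Matrix (Fin n) (Fin n) ℝ} (hP : 0 ≤ P) {l : ℕ}
    {U : Matrix (Fin n) (Fin l) ℝ} (him : im U ≤ im P) :
    ∃ κ : ℝ, 0 < κ ∧ U * Uᵀ ≤ κ • P := by
  obtain ⟨W, hW⟩ := exists_eq_mul_of_im_le him
  have hPT := transpose_eq_of_nonneg hP
  refine ⟨‖W * Wᵀ‖ * ‖P‖ + 1, by positivity, ?_⟩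
  have h1 : W * Wᵀ ≤ ‖W * Wᵀ‖ • 1 := le_norm_smul_one (by simp)
  have h2 := conj_mono h1 P
  have h3 : P * P ≤ ‖P‖ • P := sq_le_smul (norm_nonneg _) hP (le_norm_smul_one hPT)
  have h4 : U * Uᵀ = P * (W * Wᵀ) * Pᵀ := by
    rw [hW]; simp [Matrix.mul_assoc]
  rw [h4, add_smul, one_smul, mul_smul]
  refine h2.trans (le_trans ?_ (le_add_of_nonneg_right hP))
  rw [Matrix.mul_smul, Matrix.mul_one, Matrix.smul_mul, hPT]
  exact smul_le_smul_of_nonneg_left h3 (norm_nonneg _)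

end Classical

/-! ### The perturbed covariance and its multiplier -/

section Tilde
open scoped MatrixOrder

variable {n : ℕ} {P P' : Matrix (Fin n) (Fin n) ℝ}

/-- The relative entropy (doubled) that one eigenvalue `x = σ / lam` contributes to `gam`. -/
def entropyFun (x : ℝ) : ℝ := Real.log (1 - x) + (1 - x)⁻¹ - 1

theorem entropyFun_zero : entropyFun 0 = 0 := by simp [entropyFun]

theorem entropyFun_lt {x y : ℝ} (hx : 0 ≤ x) (hxy : x < y) (hy : y < 1) :
    entropyFun x < entropyFun y := by
  have hu : 0 < 1 - x := by linarith
  have hv : 0 < 1 - y := by linarith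
  have h1 := Real.log_lt_sub_one_of_pos (div_pos hu hv) (by
    rw [Ne, div_eq_one_iff_eq hv.ne']; linarith)
  rw [Real.log_div hu.ne' hv.ne'] at h1
  have h2 : (1 - x) / (1 - y) - 1 ≤ (1 - y)⁻¹ - (1 - x)⁻¹ := by
    have h3 : (1 - y)⁻¹ - (1 - x)⁻¹ - ((1 - x) / (1 - y) - 1)
        = x * (y - x) / ((1 - x) * (1 - y)) := by
      field_simp
      ring
    have h4 : 0 ≤ x * (y - x) / ((1 - x) * (1 - y)) :=
      div_nonneg (mul_nonneg hx (by linarith)) (mul_pos hu hv).le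
    linarith
  simp only [entropyFun]
  linarith

theorem entropyFun_le {x y : ℝ} (hx : 0 ≤ x) (hxy : x ≤ y) (hy : y < 1) :
    entropyFun x ≤ entropyFun y := by
  rcases hxy.eq_or_lt with rfl | h
  · exact le_rfl
  · exact (entropyFun_lt hx h hy).le

theorem entropyFun_nonneg {x : ℝ} (hx : 0 ≤ x) (hx1 : x < 1) : 0 ≤ entropyFun x :=
  entropyFun_zero ▸ entropyFun_le le_rfl hx hx1

theorem entropyFun_pos {x : ℝ} (hx : 0 < x) (hx1 : x < 1) : 0 < entropyFun x :=
  entropyFun_zero ▸ entropyFun_lt le_rfl hx hx1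

/-- `entropyFun` is unbounded near `1`. -/
theorem le_entropyFun_one_sub_inv {k : ℝ} (hk : 0 < k) : k / 2 - 1 ≤ entropyFun (1 - k⁻¹) := by
  have h1 := Real.log_le_sub_one_of_pos (half_pos hk)
  rw [Real.log_div hk.ne' two_ne_zero] at h1
  have h2 := Real.log_le_sub_one_of_pos (two_pos (α := ℝ))
  simp only [entropyFun, sub_sub_cancel, inv_inv, Real.log_inv]
  linarith

theorem continuousOn_spectrum (f : ℝ → ℝ) : ContinuousOn f (spectrum ℝ P) :=
  Matrix.finite_real_spectrum.continuousOn f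

theorem det_cfc (hP : P.IsHermitian) (f : ℝ → ℝ) : (cfc f P).det = ∏ i, f (hP.eigenvalues i) := by
  rw [hP.cfc_eq]
  simp [Matrix.IsHermitian.cfc, -Unitary.conjStarAlgAut_apply]

theorem trace_cfc (hP : P.IsHermitian) (f : ℝ → ℝ) :
    (cfc f P).trace = ∑ i, f (hP.eigenvalues i) := by
  rw [hP.cfc_eq]
  simp [Matrix.IsHermitian.cfc, Matrix.trace_mul_cycle]

theorem tilde_eq_cfc (hP : P.IsHermitian) (lam : ℝ) :
    tilde P lam = cfc (fun x => x * (1 - lam⁻¹ * x)⁻¹) P := by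
  have hsa : IsSelfAdjoint P := hP
  have h1 : imProj P = cfc (fun x : ℝ => x * x⁻¹) P := by
    rw [cfc_mul (fun x => x) _ P (continuousOn_spectrum _) (continuousOn_spectrum _), cfc_id' ℝ P]
    rfl
  have h2 : pinv P - lam⁻¹ • imProj P = cfc (fun x : ℝ => x⁻¹ - lam⁻¹ * (x * x⁻¹)) P := by
    rw [cfc_sub _ _ P (continuousOn_spectrum _) (continuousOn_spectrum _),
      cfc_const_mul _ _ P (continuousOn_spectrum _), h1]
    rfl
  rw [tilde, h2, pinv, ← cfc_comp' _ _ P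
    ((Matrix.finite_real_spectrum.image _).continuousOn _) (continuousOn_spectrum _)]
  refine cfc_congr fun x _ => ?_
  rcases eq_or_ne x 0 with rfl | hx
  · simp
  · have : x⁻¹ - lam⁻¹ * (x * x⁻¹) = x⁻¹ * (1 - lam⁻¹ * x) := by
      field_simp
    rw [this, mul_inv, inv_inv]

theorem gam_eq_sum (hP : P.IsHermitian) {lam : ℝ} (h : ∀ i, lam⁻¹ * hP.eigenvalues i < 1) :
    gam P lam = 1 / 2 * ∑ i, entropyFun (lam⁻¹ * hP.eigenvalues i) := by
  have hsa : IsSelfAdjoint P := hP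
  have h1 : Real.log (pdet P) = ∑ i, Real.log (hP.eigenvalues i) := by
    rw [pdet, det_cfc hP, Real.log_prod fun i _ => by split_ifs with hi; exacts [one_ne_zero, hi]]
    refine Finset.sum_congr rfl fun i _ => ?_
    split_ifs with hi <;> simp [hi]
  have h2 : Real.log (pdet (tilde P lam))
      = ∑ i, (Real.log (hP.eigenvalues i)
        - if hP.eigenvalues i = 0 then 0 else Real.log (1 - lam⁻¹ * hP.eigenvalues i)) := by
    rw [pdet, tilde_eq_cfc hP, ← cfc_comp' _ _ P
      ((Matrix.finite_real_spectrum.image _).continuousOn _) (continuousOn_spectrum _),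
      det_cfc hP, Real.log_prod fun i _ => by split_ifs with hi; exacts [one_ne_zero, hi]]
    refine Finset.sum_congr rfl fun i _ => ?_
    have hi1 : 1 - lam⁻¹ * hP.eigenvalues i ≠ 0 := by linarith [h i]
    by_cases hi : hP.eigenvalues i = 0
    · simp [hi]
    · rw [if_neg (mul_ne_zero hi (inv_ne_zero hi1)), if_neg hi,
        Real.log_mul hi (inv_ne_zero hi1), Real.log_inv]
      ring
  have h3 : (pinv P * tilde P lam).trace
      = ∑ i, (hP.eigenvalues i)⁻¹ * (hP.eigenvalues i * (1 - lam⁻¹ * hP.eigenvalues i)⁻¹) := by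
    rw [tilde_eq_cfc hP, pinv, ← cfc_mul _ _ P (continuousOn_spectrum _) (continuousOn_spectrum _),
      trace_cfc hP]
  have h4 : (P.rank : ℝ) = ∑ i, if hP.eigenvalues i = 0 then (0 : ℝ) else 1 := by
    rw [hP.rank_eq_card_non_zero_eigs, Fintype.card_subtype, Finset.sum_ite]
    simp
  rw [gam, h1, h2, h3, h4, ← Finset.sum_sub_distrib, ← Finset.sum_sub_distrib,
    ← Finset.sum_add_distrib]
  congr 1
  refine Finset.sum_congr rfl fun i _ => ?_
  by_cases hi : hP.eigenvalues i = 0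
  · simp [hi, entropyFun]
  · rw [if_neg hi, if_neg hi, inv_mul_cancel_left₀ hi, entropyFun]
    ring

theorem sum_entropyFun_lt (hP : 0 ≤ P) (h0 : P ≠ 0) (hH : P.IsHermitian) {s t : ℝ} (hs : 0 ≤ s)
    (hst : s < t) (ht : ∀ i, t * hH.eigenvalues i < 1) :
    ∑ i, entropyFun (s * hH.eigenvalues i) < ∑ i, entropyFun (t * hH.eigenvalues i) := by
  have hev : ∀ i, 0 ≤ hH.eigenvalues i :=
    (Matrix.nonneg_iff_posSemidef.1 hP).eigenvalues_nonneg
  obtain ⟨i, hi⟩ : ∃ i, hH.eigenvalues i ≠ 0 := by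
    by_contra! h
    exact h0 (hH.eigenvalues_eq_zero_iff.1 (funext h))
  refine Finset.sum_lt_sum (fun j _ => ?_) ⟨i, Finset.mem_univ i, ?_⟩
  · exact entropyFun_le (mul_nonneg hs (hev j)) (mul_le_mul_of_nonneg_right hst.le (hev j)) (ht j)
  · exact entropyFun_lt (mul_nonneg hs (hev i))
      (mul_lt_mul_of_pos_right hst (lt_of_le_of_ne (hev i) hi.symm)) (ht i)

/-- A nonzero covariance has a multiplier for every tolerance, by the intermediate value
theorem. -/
theorem exists_isMultiplier (hP : 0 ≤ P) (h0 : P ≠ 0) {c : ℝ} (hc : 0 < c) :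
    ∃ lam, IsMultiplier c P lam := by
  have hpsd := Matrix.nonneg_iff_posSemidef.1 hP
  have hH := hpsd.1
  have hev : ∀ i, 0 ≤ hH.eigenvalues i := hpsd.eigenvalues_nonneg
  obtain ⟨i, hi⟩ : ∃ i, hH.eigenvalues i ≠ 0 := by
    by_contra! h
    exact h0 (hH.eigenvalues_eq_zero_iff.1 (funext h))
  obtain ⟨j, -, hj⟩ := Finset.exists_max_image Finset.univ hH.eigenvalues ⟨i, Finset.mem_univ i⟩
  have hj' : ∀ i, hH.eigenvalues i ≤ hH.eigenvalues j := fun i => hj i (Finset.mem_univ i)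
  have hs : 0 < hH.eigenvalues j := lt_of_lt_of_le (lt_of_le_of_ne (hev i) hi.symm) (hj' i)
  set s := hH.eigenvalues j with hs'
  -- at `b` the largest eigenvalue alone contributes at least `2 c`
  set k : ℝ := 4 * c + 2 with hk
  have hk0 : 0 < k := by positivity
  have hk1 : k⁻¹ < 1 := inv_lt_one_of_one_lt₀ (by linarith)
  set b : ℝ := (1 - k⁻¹) / s with hb
  have hb0 : 0 ≤ b := div_nonneg (by linarith) hs.le
  have hlt : ∀ t ∈ Set.Icc 0 b, ∀ i, t * hH.eigenvalues i < 1 := fun t ht i =>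
    calc t * hH.eigenvalues i ≤ b * s := mul_le_mul ht.2 (hj' i) (hev i) hb0
      _ = 1 - k⁻¹ := div_mul_cancel₀ _ hs.ne'
      _ < 1 := by linarith [inv_pos.2 hk0]
  have hcont : ContinuousOn (fun t => ∑ i, entropyFun (t * hH.eigenvalues i)) (Set.Icc 0 b) := by
    refine continuousOn_finsetSum _ fun i _ => ?_
    have hne : ∀ t ∈ Set.Icc 0 b, 1 - t * hH.eigenvalues i ≠ 0 := fun t ht => by
      linarith [hlt t ht i]
    have h1 : ContinuousOn (fun t => 1 - t * hH.eigenvalues i) (Set.Icc 0 b) := by fun_prop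
    exact ((h1.log hne).add (h1.inv₀ hne)).sub continuousOn_const
  have hend : 2 * c ≤ ∑ i, entropyFun (b * hH.eigenvalues i) := by
    calc 2 * c = k / 2 - 1 := by rw [hk]; ring
      _ ≤ entropyFun (1 - k⁻¹) := le_entropyFun_one_sub_inv hk0
      _ = entropyFun (b * s) := by rw [hb, div_mul_cancel₀ _ hs.ne']
      _ ≤ _ := Finset.single_le_sum (f := fun i => entropyFun (b * hH.eigenvalues i))
          (fun i _ => entropyFun_nonneg (mul_nonneg hb0 (hev i)) (hlt b ⟨hb0, le_rfl⟩ i))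
          (Finset.mem_univ j)
  obtain ⟨t, ht, htc⟩ := intermediate_value_Icc hb0 hcont
    (show 2 * c ∈ Set.Icc _ _ from ⟨by simp [entropyFun_zero, hc.le], hend⟩)
  simp only at htc
  have ht0 : 0 < t := by
    refine lt_of_le_of_ne ht.1 ?_
    rintro rfl
    simp [entropyFun_zero] at htc
    exact hc.ne' htc
  refine ⟨t⁻¹, inv_pos.2 ht0, fun x hx => ?_, ?_⟩
  · rw [hH.spectrum_real_eq_range_eigenvalues] at hx
    obtain ⟨i, rfl⟩ := hx
    rw [← one_div, lt_div_iff₀ ht0, mul_comm]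
    exact hlt t ht i
  · rw [gam_eq_sum hH (by simpa using hlt t ht), inv_inv, htc]
    ring

/-- The risk-sensitivity parameter of `P` at the tolerance `c`: the inverse of the multiplier, and
`0` when `P = 0`. -/
def theta (c : ℝ) (P : Matrix (Fin n) (Fin n) ℝ) : ℝ :=
  open Classical in if P = 0 then 0 else (multiplier c P)⁻¹

/-- The amplification factor `(1 - θ P)⁻¹`, for which the perturbed covariance is `Z P`. -/
def amp (c : ℝ) (P : Matrix (Fin n) (Fin n) ℝ) : Matrix (Fin n) (Fin n) ℝ :=
  cfc (fun x => (1 - theta c P * x)⁻¹) P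

theorem theta_spec (hP : 0 ≤ P) (hH : P.IsHermitian) (h0 : P ≠ 0) {c : ℝ} (hc : 0 < c) :
    0 < theta c P ∧ (∀ i, theta c P * hH.eigenvalues i < 1) ∧
      ∑ i, entropyFun (theta c P * hH.eigenvalues i) = 2 * c := by
  obtain ⟨h1, h2, h3⟩ : IsMultiplier c P (multiplier c P) :=
    Classical.epsilon_spec (exists_isMultiplier hP h0 hc)
  have hth : theta c P = (multiplier c P)⁻¹ := if_neg h0
  have hlt : ∀ i, (multiplier c P)⁻¹ * hH.eigenvalues i < 1 := fun i => by
    rw [inv_mul_lt_iff₀ h1, mul_one]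
    exact h2 _ (hH.eigenvalues_mem_spectrum_real i)
  rw [hth]
  refine ⟨inv_pos.2 h1, hlt, ?_⟩
  rw [gam_eq_sum hH hlt] at h3
  linarith

/-- For small tolerances `θ P` is small: a single eigenvalue already bounds the relative entropy
from below. -/
theorem theta_mul_le (hP : 0 ≤ P) {c ε : ℝ} (hc : 0 < c) (hε : 0 < ε)
    (hcε : 2 * c ≤ entropyFun ε) {x : ℝ} (hx : x ∈ spectrum ℝ P) :
    0 ≤ theta c P * x ∧ theta c P * x ≤ ε := by
  have hpsd := Matrix.nonneg_iff_posSemidef.1 hP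
  have hH := hpsd.1
  have hev : ∀ i, 0 ≤ hH.eigenvalues i := hpsd.eigenvalues_nonneg
  rw [hH.spectrum_real_eq_range_eigenvalues] at hx
  obtain ⟨i, rfl⟩ := hx
  rcases eq_or_ne P 0 with h0 | h0
  · rw [theta, if_pos h0]; simp [hε.le]
  · obtain ⟨h1, h2, h3⟩ := theta_spec hP hH h0 hc
    have hnn : ∀ i, 0 ≤ theta c P * hH.eigenvalues i := fun i => mul_nonneg h1.le (hev i)
    refine ⟨hnn i, ?_⟩
    by_contra! hlt
    have h4 := entropyFun_lt hε.le hlt (h2 i)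
    have h5 := Finset.single_le_sum (f := fun i => entropyFun (theta c P * hH.eigenvalues i))
      (fun i _ => entropyFun_nonneg (hnn i) (h2 i)) (Finset.mem_univ i)
    simp only [h3] at h5
    linarith

theorem tilde_multiplier_eq_cfc (hP : 0 ≤ P) (c : ℝ) :
    tilde P (multiplier c P) = cfc (fun x => x * (1 - theta c P * x)⁻¹) P := by
  rw [tilde_eq_cfc (Matrix.nonneg_iff_posSemidef.1 hP).1]
  rcases eq_or_ne P 0 with rfl | h0
  · refine cfc_congr fun x hx => ?_
    have : x = 0 := by
      rw [(Matrix.isHermitian_zero (n := Fin n) (α := ℝ)).spectrum_real_eq_range_eigenvalues] at hx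
      obtain ⟨i, rfl⟩ := hx
      exact congrFun
        ((Matrix.isHermitian_zero (n := Fin n) (α := ℝ)).eigenvalues_eq_zero_iff.2 rfl) i
    simp [this]
  · rw [theta, if_neg h0]

theorem mul_cfc (hP : P.IsHermitian) (f : ℝ → ℝ) : P * cfc f P = cfc (fun x => x * f x) P := by
  have hsa : IsSelfAdjoint P := hP
  rw [cfc_mul (fun x => x) f P (continuousOn_spectrum _) (continuousOn_spectrum _), cfc_id' ℝ P]

theorem cfc_mul_comm (hP : P.IsHermitian) (f : ℝ → ℝ) : cfc f P * P = P * cfc f P := by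
  have hsa : IsSelfAdjoint P := hP
  rw [mul_cfc hP, show (fun x => x * f x) = fun x => f x * x from funext fun x => mul_comm _ _,
    cfc_mul f (fun x => x) P (continuousOn_spectrum _) (continuousOn_spectrum _), cfc_id' ℝ P]

theorem tilde_multiplier (hP : 0 ≤ P) (c : ℝ) :
    tilde P (multiplier c P) = amp c P * P ∧ tilde P (multiplier c P) = P * amp c P := by
  have hH := (Matrix.nonneg_iff_posSemidef.1 hP).1
  rw [tilde_multiplier_eq_cfc hP, amp, cfc_mul_comm hH, mul_cfc hH]
  exact ⟨rfl, rfl⟩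

theorem amp_transpose (c : ℝ) : (amp c P)ᵀ = amp c P := by
  have : IsSelfAdjoint (amp c P) := cfc_predicate _ P
  simpa [IsSelfAdjoint, Matrix.star_eq_conjTranspose] using this

theorem one_sub_smul_eq_cfc (hP : P.IsHermitian) (t : ℝ) :
    1 - t • P = cfc (fun x => 1 - t * x) P := by
  have hsa : IsSelfAdjoint P := hP
  rw [cfc_sub _ _ P (continuousOn_spectrum _) (continuousOn_spectrum _), cfc_const_one ℝ P,
    cfc_const_mul _ _ P (continuousOn_spectrum _), cfc_id' ℝ P]

theorem cfc_inv_mul_one_sub (hP : P.IsHermitian) {t : ℝ} (h : ∀ x ∈ spectrum ℝ P, t * x < 1) :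
    cfc (fun x => (1 - t * x)⁻¹) P * (1 - t • P) = 1 := by
  have hsa : IsSelfAdjoint P := hP
  rw [one_sub_smul_eq_cfc hP, ← cfc_mul _ _ P (continuousOn_spectrum _) (continuousOn_spectrum _),
    ← cfc_const_one ℝ P]
  exact cfc_congr fun x hx => inv_mul_cancel₀ (by linarith [h x hx])

theorem amp_mul (hP : 0 ≤ P) {c ε : ℝ} (hc : 0 < c) (hε : 0 < ε) (hε1 : ε < 1)
    (hcε : 2 * c ≤ entropyFun ε) : amp c P * (1 - theta c P • P) = 1 :=
  cfc_inv_mul_one_sub (Matrix.nonneg_iff_posSemidef.1 hP).1 fun _ hx =>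
    (theta_mul_le hP hc hε hcε hx).2.trans_lt hε1

/-- The perturbation inflates the covariance, by a bounded factor. -/
theorem le_tilde_and_tilde_le (hP : 0 ≤ P) {c ε : ℝ} (hc : 0 < c) (hε : 0 < ε) (hε1 : ε < 1)
    (hcε : 2 * c ≤ entropyFun ε) :
    P ≤ tilde P (multiplier c P) ∧ tilde P (multiplier c P) ≤ (1 - ε)⁻¹ • P := by
  have hsa : IsSelfAdjoint P := IsSelfAdjoint.of_nonneg hP
  have key : ∀ x ∈ spectrum ℝ P, 0 ≤ x ∧ 0 ≤ theta c P * x ∧ theta c P * x ≤ ε := fun x hx =>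
    ⟨spectrum_nonneg_of_nonneg hP hx, theta_mul_le hP hc hε hcε hx⟩
  rw [tilde_multiplier_eq_cfc hP]
  constructor
  · nth_rw 1 [← cfc_id' ℝ P]
    refine (cfc_le_iff _ _ P (continuousOn_spectrum _) (continuousOn_spectrum _)).2 fun x hx => ?_
    obtain ⟨h1, h2, h3⟩ := key x hx
    exact le_mul_of_one_le_right h1 ((one_le_inv₀ (by linarith)).2 (by linarith))
  · nth_rw 3 [← cfc_id' ℝ P]
    rw [← cfc_const_mul _ _ P (continuousOn_spectrum _)]
    refine (cfc_le_iff _ _ P (continuousOn_spectrum _) (continuousOn_spectrum _)).2 fun x hx => ?_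
    obtain ⟨h1, h2, h3⟩ := key x hx
    rw [mul_comm]
    exact mul_le_mul_of_nonneg_right (inv_anti₀ (by linarith) (by linarith)) h1

open scoped Matrix.Norms.L2Operator in
theorem norm_amp_sub_one_le (hP : 0 ≤ P) {c ε : ℝ} (hc : 0 < c) (hε : 0 < ε) (hε1 : ε < 1)
    (hcε : 2 * c ≤ entropyFun ε) : ‖amp c P - 1‖ ≤ ε / (1 - ε) := by
  have hsa : IsSelfAdjoint P := IsSelfAdjoint.of_nonneg hP
  rw [amp, ← cfc_const_one ℝ P, ← cfc_sub _ _ P (continuousOn_spectrum _) (continuousOn_spectrum _)]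
  refine norm_cfc_le (div_nonneg hε.le (by linarith)) fun x hx => ?_
  obtain ⟨h2, h3⟩ := theta_mul_le hP hc hε hcε hx
  have h4 : (1 - theta c P * x)⁻¹ - 1 = theta c P * x / (1 - theta c P * x) := by
    have : 1 - theta c P * x ≠ 0 := by linarith
    field_simp
    ring
  rw [h4, Real.norm_of_nonneg (div_nonneg h2 (by linarith))]
  exact div_le_div₀ hε.le h3 (by linarith) (by linarith)

open scoped Matrix.Norms.L2Operator in
theorem theta_mul_norm_le (hP : 0 ≤ P) {c ε : ℝ} (hc : 0 < c) (hε : 0 < ε)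
    (hcε : 2 * c ≤ entropyFun ε) : 0 ≤ theta c P ∧ theta c P * ‖P‖ ≤ ε := by
  have hsa : IsSelfAdjoint P := IsSelfAdjoint.of_nonneg hP
  have h0 : 0 ≤ theta c P := by
    rcases eq_or_ne P 0 with h0 | h0
    · rw [theta, if_pos h0]
    · exact (theta_spec hP (Matrix.nonneg_iff_posSemidef.1 hP).1 h0 hc).1.le
  refine ⟨h0, ?_⟩
  rw [← Real.norm_of_nonneg h0, ← norm_smul]
  have : theta c P • P = cfc (fun x => theta c P * x) P := by
    rw [cfc_const_mul _ _ P (continuousOn_spectrum _), cfc_id' ℝ P]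
  rw [this]
  refine norm_cfc_le hε.le fun x hx => ?_
  obtain ⟨h2, h3⟩ := theta_mul_le hP hc hε hcε hx
  rwa [Real.norm_of_nonneg h2]

theorem log_det_le (hP : 0 ≤ P) (hdet : 0 < P.det) : Real.log P.det ≤ P.trace - n := by
  have hpsd := Matrix.nonneg_iff_posSemidef.1 hP
  have hdet' : P.det = ∏ i, hpsd.1.eigenvalues i := by
    simpa using hpsd.1.det_eq_prod_eigenvalues
  have htr : P.trace = ∑ i, hpsd.1.eigenvalues i := by
    simpa using hpsd.1.trace_eq_sum_eigenvalues
  have hne : ∀ i ∈ Finset.univ, hpsd.1.eigenvalues i ≠ 0 :=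
    Finset.prod_ne_zero_iff.1 (hdet' ▸ hdet.ne')
  rw [hdet', Real.log_prod hne, htr]
  calc ∑ i, Real.log (hpsd.1.eigenvalues i) ≤ ∑ i, (hpsd.1.eigenvalues i - 1) :=
        Finset.sum_le_sum fun i hi => Real.log_le_sub_one_of_pos
          (lt_of_le_of_ne (hpsd.eigenvalues_nonneg i) (hne i hi).symm)
    _ = _ := by simp

theorem trace_mul_nonneg {M N : Matrix (Fin n) (Fin n) ℝ} (hM : 0 ≤ M) (hN : 0 ≤ N) :
    0 ≤ (M * N).trace := by
  obtain ⟨S, hS⟩ := exists_eq_mul_transpose hM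
  rw [hS, Matrix.mul_assoc, Matrix.trace_mul_comm]
  have := conj_nonneg hN Sᵀ
  rw [Matrix.transpose_transpose] at this
  exact (Matrix.nonneg_iff_posSemidef.1 this).trace_nonneg

/-- The relative entropy `log det (1 - X) + tr (1 - X)⁻¹` is monotone in the Löwner order: with
`V = 1 - Y ≤ U = 1 - X ≤ 1`, concavity of `log det` gives
`log det U - log det V ≤ tr (V⁻¹ U) - n = tr ((V⁻¹ - U⁻¹) U) ≤ tr (V⁻¹ - U⁻¹)`. -/
theorem log_det_add_trace_inv_le {U V : Matrix (Fin n) (Fin n) ℝ} (hV : V.PosDef) (hVU : V ≤ U)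
    (hU : U ≤ 1) :
    Real.log U.det + (U⁻¹).trace ≤ Real.log V.det + (V⁻¹).trace := by
  have hV0 : 0 ≤ V := hV.posSemidef.nonneg
  have hUpos : U.PosDef := by
    have := hV.add_posSemidef (Matrix.le_iff.1 hVU)
    rwa [add_sub_cancel] at this
  have hU1 : U * U⁻¹ = 1 := Matrix.mul_nonsing_inv _ hUpos.det_pos.ne'.isUnit
  have hU2 : U⁻¹ * U = 1 := Matrix.nonsing_inv_mul _ hUpos.det_pos.ne'.isUnit
  have hV1 : V * V⁻¹ = 1 := Matrix.mul_nonsing_inv _ hV.det_pos.ne'.isUnit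
  have hV2 : V⁻¹ * V = 1 := Matrix.nonsing_inv_mul _ hV.det_pos.ne'.isUnit
  have hVi : 0 ≤ V⁻¹ := hV.inv.posSemidef.nonneg
  have hUi : 0 ≤ U⁻¹ := hUpos.inv.posSemidef.nonneg
  have h1 : 0 ≤ V⁻¹ - U⁻¹ := by
    have hUiT := transpose_eq_of_nonneg hUi
    have h2 := conj_nonneg (sub_nonneg.2 hVU) U⁻¹
    have h3 := conj_nonneg hVi (U⁻¹ * (U - V))
    have h4 : V⁻¹ - U⁻¹ = U⁻¹ * (U - V) * (U⁻¹)ᵀ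
        + U⁻¹ * (U - V) * V⁻¹ * (U⁻¹ * (U - V))ᵀ := by
      have hT : (U - V)ᵀ = U - V := transpose_eq_of_nonneg (sub_nonneg.2 hVU)
      have e1 : U⁻¹ * (U - V) * V⁻¹ = V⁻¹ - U⁻¹ := by
        rw [Matrix.mul_sub, hU2, Matrix.sub_mul, Matrix.one_mul, Matrix.mul_assoc, hV1,
          Matrix.mul_one]
      have e2 : V⁻¹ * ((U - V) * U⁻¹) = V⁻¹ - U⁻¹ := by
        rw [Matrix.sub_mul, hU1, Matrix.mul_sub, ← Matrix.mul_assoc, hV2, Matrix.mul_one,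
          Matrix.one_mul]
      have e3 : U⁻¹ * (U - V) * U⁻¹ = U⁻¹ - U⁻¹ * V * U⁻¹ := by
        rw [Matrix.mul_sub, hU2, Matrix.sub_mul, Matrix.one_mul]
      rw [Matrix.transpose_mul, hUiT, hT, e1, Matrix.sub_mul, e2, e3, Matrix.sub_mul, hU1]
      simp only [Matrix.mul_sub, Matrix.mul_one, Matrix.mul_assoc]
      abel
    rw [h4]
    exact add_nonneg h2 h3
  have h2 : 0 ≤ ((V⁻¹ - U⁻¹) * (1 - U)).trace := trace_mul_nonneg h1 (sub_nonneg.2 hU)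
  obtain ⟨T, hT⟩ := exists_eq_mul_transpose hVi
  have h3 : (Tᵀ * U * T).det = U.det / V.det := by
    have : T.det * Tᵀ.det = (V.det)⁻¹ := by
      rw [← Matrix.det_mul, ← hT, Matrix.det_nonsing_inv, Ring.inverse_eq_inv']
    rw [Matrix.det_mul, Matrix.det_mul, div_eq_mul_inv, ← this]
    ring
  have h4 : (Tᵀ * U * T).trace = (V⁻¹ * U).trace := by
    rw [hT, Matrix.trace_mul_cycle, Matrix.mul_assoc]
  have h5 := log_det_le (P := Tᵀ * U * T)
    (by simpa using conj_nonneg (hV0.trans hVU) Tᵀ) (h3 ▸ div_pos hUpos.det_pos hV.det_pos)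
  rw [h3, h4, Real.log_div hUpos.det_pos.ne' hV.det_pos.ne'] at h5
  rw [Matrix.mul_sub, Matrix.mul_one, Matrix.trace_sub, Matrix.sub_mul, hU2, Matrix.trace_sub,
    Matrix.trace_sub, Matrix.trace_one, Fintype.card_fin] at h2
  linarith

theorem posDef_one_sub_smul (hH : P.IsHermitian) {t : ℝ} (h : ∀ i, t * hH.eigenvalues i < 1) :
    (1 - t • P).PosDef := by
  have hsa : IsSelfAdjoint P := hH
  have h0 : 0 ≤ 1 - t • P := by
    rw [one_sub_smul_eq_cfc hH]
    refine cfc_nonneg fun x hx => ?_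
    rw [hH.spectrum_real_eq_range_eigenvalues] at hx
    obtain ⟨i, rfl⟩ := hx
    linarith [h i]
  rw [(Matrix.nonneg_iff_posSemidef.1 h0).posDef_iff_det_ne_zero, one_sub_smul_eq_cfc hH,
    det_cfc hH]
  exact Finset.prod_ne_zero_iff.2 fun i _ => by linarith [h i]

theorem sum_entropyFun_eq (hH : P.IsHermitian) {t : ℝ} (h : ∀ i, t * hH.eigenvalues i < 1) :
    ∑ i, entropyFun (t * hH.eigenvalues i)
      = Real.log (1 - t • P).det + ((1 - t • P)⁻¹).trace - n := by
  have hspec : ∀ x ∈ spectrum ℝ P, t * x < 1 := fun x hx => by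
    rw [hH.spectrum_real_eq_range_eigenvalues] at hx
    obtain ⟨i, rfl⟩ := hx
    exact h i
  rw [Matrix.inv_eq_left_inv (cfc_inv_mul_one_sub hH hspec), trace_cfc hH, one_sub_smul_eq_cfc hH,
    det_cfc hH, Real.log_prod fun i _ => by linarith [h i]]
  simp [entropyFun, Finset.sum_add_distrib]

/-- `θ` is antitone in the covariance and homogeneous of degree `-1`. -/
theorem theta_le_mul_theta (hP : 0 ≤ P) (hP' : 0 ≤ P') (h0 : P ≠ 0) (h0' : P' ≠ 0) {a c : ℝ}
    (ha : 0 < a) (hc : 0 < c) (hle : P ≤ a • P') : theta c P' ≤ a * theta c P := by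
  by_contra! hlt
  have hH := (Matrix.nonneg_iff_posSemidef.1 hP).1
  have hH' := (Matrix.nonneg_iff_posSemidef.1 hP').1
  have hev' : ∀ i, 0 ≤ hH'.eigenvalues i :=
    (Matrix.nonneg_iff_posSemidef.1 hP').eigenvalues_nonneg
  obtain ⟨h1, h2, h3⟩ := theta_spec hP hH h0 hc
  obtain ⟨h1', h2', h3'⟩ := theta_spec hP' hH' h0' hc
  have ht : ∀ i, theta c P * a * hH'.eigenvalues i < 1 := fun i =>
    lt_of_le_of_lt (mul_le_mul_of_nonneg_right (by linarith [mul_comm a (theta c P)]) (hev' i))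
      (h2' i)
  have h4 := sum_entropyFun_lt hP' h0' hH' (s := theta c P * a) (by positivity)
    (by linarith [mul_comm a (theta c P)]) h2'
  have h5 : theta c P • P ≤ (theta c P * a) • P' := by
    rw [mul_smul]
    exact smul_le_smul_of_nonneg_left hle h1.le
  have h6 := log_det_add_trace_inv_le (posDef_one_sub_smul hH' ht) (sub_le_sub_left h5 1)
    (sub_le_self _ (smul_nonneg h1.le hP))
  rw [sum_entropyFun_eq hH' ht] at h4
  rw [sum_entropyFun_eq hH h2] at h3
  linarith

end Tilde

/-! ### Differences of robust iterates -/

section Robust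
open scoped MatrixOrder Matrix.Norms.L2Operator

variable {n m p l : ℕ} {A : Matrix (Fin n) (Fin n) ℝ} {B : Matrix (Fin n) (Fin m) ℝ}
  {C : Matrix (Fin p) (Fin n) ℝ} {D : Matrix (Fin p) (Fin m) ℝ} {X P P' : Matrix (Fin n) (Fin n) ℝ}
  {c ε : ℝ}

theorem robustRiccati_bounds (hR : (D * Dᵀ).PosDef) (hX : 0 ≤ X) (hc : 0 < c) (hε : 0 < ε)
    (hε1 : ε < 1) (hcε : 2 * c ≤ entropyFun ε) :
    riccati A B C D X ≤ robustRiccati A B C D c X ∧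
      robustRiccati A B C D c X ≤ (1 - ε)⁻¹ • riccati A B C D X := by
  obtain ⟨h1, h2⟩ := le_tilde_and_tilde_le hX hc hε hε1 hcε
  exact ⟨riccati_mono hR hX h1, (riccati_mono hR (hX.trans h1) h2).trans
    (riccati_smul_le hR hX ((one_le_inv₀ (by linarith)).2 (by linarith)))⟩

/-- The robust iterates are sandwiched between the classical ones and a multiple of them, because
the Riccati map is monotone and subhomogeneous. -/
theorem iterate_robustRiccati_bounds (hR : (D * Dᵀ).PosDef) (hX : 0 ≤ X) (hc : 0 < c) (hε : 0 < ε)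
    (hε1 : ε < 1) (hcε : 2 * c ≤ entropyFun ε) (t : ℕ) :
    (riccati A B C D)^[t] X ≤ (robustRiccati A B C D c)^[t] X ∧
      (robustRiccati A B C D c)^[t] X ≤ ((1 - ε)⁻¹) ^ t • (riccati A B C D)^[t] X := by
  induction t with
  | zero => simp
  | succ t ih =>
    have ha : 1 ≤ (1 - ε)⁻¹ := (one_le_inv₀ (by linarith)).2 (by linarith)
    have h0 := iterate_riccati_nonneg (A := A) (B := B) (C := C) hR hX t
    have h1 := h0.trans ih.1
    obtain ⟨h2, h3⟩ := robustRiccati_bounds (A := A) (B := B) (C := C) hR h1 hc hε hε1 hcε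
    rw [Function.iterate_succ_apply', Function.iterate_succ_apply']
    refine ⟨(riccati_mono hR h0 ih.1).trans h2, h3.trans ?_⟩
    rw [pow_succ', mul_smul]
    refine smul_le_smul_of_nonneg_left ?_ (zero_le_one.trans ha)
    exact (riccati_mono hR h1 ih.2).trans (riccati_smul_le hR h0 (one_le_pow₀ ha))

theorem proj_mul_iterate_robustRiccati {Q : Matrix (Fin n) (Fin n) ℝ} (hQB : Q * B = B)
    (hQA : Q * (A * Q) = A * Q) (hR : (D * Dᵀ).PosDef) (hX : 0 ≤ X) (hQX : Q * X = X) (hc : 0 < c)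
    (hε : 0 < ε) (hε1 : ε < 1) (hcε : 2 * c ≤ entropyFun ε) (t : ℕ) :
    Q * (robustRiccati A B C D c)^[t] X = (robustRiccati A B C D c)^[t] X := by
  induction t with
  | zero => exact hQX
  | succ t ih =>
    have h0 := (iterate_riccati_nonneg (A := A) (B := B) (C := C) hR hX t).trans
      (iterate_robustRiccati_bounds (A := A) (B := B) (C := C) hR hX hc hε hε1 hcε t).1
    rw [Function.iterate_succ_apply']
    generalize (robustRiccati A B C D c)^[t] X = Y at *
    have h1 : Q * tilde Y (multiplier c Y) = tilde Y (multiplier c Y) := by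
      rw [(tilde_multiplier h0 c).2, ← Matrix.mul_assoc, ih]
    rw [robustRiccati]
    generalize tilde Y (multiplier c Y) = T at *
    have h2 : Q * (A * T) = A * T := by
      rw [← h1, ← Matrix.mul_assoc A, ← Matrix.mul_assoc, hQA]
    simp only [riccati, Matrix.mul_add, Matrix.mul_sub, ← Matrix.mul_assoc]
    simp only [← Matrix.mul_assoc] at h2
    rw [h2, hQB]

/-- The matrix that carries the difference of two covariances through one robust step. -/
def robustLoop (A : Matrix (Fin n) (Fin n) ℝ) (C : Matrix (Fin p) (Fin n) ℝ)
    (D : Matrix (Fin p) (Fin m) ℝ) (P Z : Matrix (Fin n) (Fin n) ℝ) : Matrix (Fin n) (Fin n) ℝ :=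
  closedLoop A C D (Z * P) * Z

/-- The difference of two robust steps, by `riccati_sub` and the resolvent identity for
`(1 - θ P)⁻¹ P`. -/
theorem robustRiccati_sub (hR : (D * Dᵀ).PosDef) (hP : 0 ≤ P) (hP' : 0 ≤ P') (hc : 0 < c)
    (hε : 0 < ε) (hε1 : ε < 1) (hcε : 2 * c ≤ entropyFun ε) :
    robustRiccati A B C D c P - robustRiccati A B C D c P'
      = robustLoop A C D P (amp c P) * (P - P' + (theta c P - theta c P') • (P * P'))
        * (robustLoop A C D P' (amp c P'))ᵀ := by
  have h1 := hP.trans (le_tilde_and_tilde_le hP hc hε hε1 hcε).1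
  have h1' := hP'.trans (le_tilde_and_tilde_le hP' hc hε hε1 hcε).1
  have h2 := amp_mul hP hc hε hε1 hcε
  have h3 : (1 - theta c P' • P') * amp c P' = 1 :=
    mul_eq_one_comm.1 (amp_mul hP' hc hε hε1 hcε)
  have key : tilde P (multiplier c P) - tilde P' (multiplier c P')
      = amp c P * (P - P' + (theta c P - theta c P') • (P * P')) * amp c P' := by
    have h4 : P - P' + (theta c P - theta c P') • (P * P')
        = P * (1 - theta c P' • P') - (1 - theta c P • P) * P' := by
      simp only [mul_sub, sub_mul, Matrix.mul_smul, Matrix.smul_mul, mul_one, one_mul, sub_smul]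
      abel
    rw [h4, mul_sub, sub_mul, ← mul_assoc (amp c P) (1 - theta c P • P), h2, one_mul,
      mul_assoc, mul_assoc P, h3, mul_one, (tilde_multiplier hP c).1, (tilde_multiplier hP' c).2]
  rw [robustRiccati, robustRiccati, riccati_sub hR h1 h1', key, robustLoop, robustLoop,
    Matrix.transpose_mul, amp_transpose, ← (tilde_multiplier hP c).1, ← (tilde_multiplier hP' c).1]
  simp only [Matrix.mul_assoc]

theorem exists_norm_robustLoop_sub_le (hR : (D * Dᵀ).PosDef) (hP : 0 ≤ P) {μ : ℝ} (hμ : 0 < μ) :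
    ∃ δ > 0, ∀ Q Z : Matrix (Fin n) (Fin n) ℝ, ‖Q - P‖ ≤ δ → ‖Z - 1‖ ≤ δ →
      ‖robustLoop A C D Q Z - closedLoop A C D P‖ ≤ μ := by
  have h1 : ContinuousAt (fun q : Matrix (Fin n) (Fin n) ℝ × Matrix (Fin n) (Fin n) ℝ =>
      closedLoop A C D (q.2 * q.1) * q.2) (P, 1) := by
    refine ContinuousAt.mul ?_ continuousAt_snd
    refine ContinuousAt.comp (g := closedLoop A C D)
      (f := fun q : Matrix (Fin n) (Fin n) ℝ × Matrix (Fin n) (Fin n) ℝ => q.2 * q.1) ?_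
      (continuousAt_snd.mul continuousAt_fst)
    simpa using continuousAt_closedLoop hR hP
  obtain ⟨δ, hδ, h⟩ := Metric.continuousAt_iff.1 h1 μ hμ
  refine ⟨δ / 2, half_pos hδ, fun Q Z hQ hZ => ?_⟩
  have h2 := @h (Q, Z) (by
    rw [Prod.dist_eq, max_lt_iff, dist_eq_norm, dist_eq_norm]
    exact ⟨hQ.trans_lt (half_lt_self hδ), hZ.trans_lt (half_lt_self hδ)⟩)
  rw [dist_eq_norm] at h2
  simpa [robustLoop] using h2.le

/-- Perturbing both factors and the middle of `L X Lᵀ`. -/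
theorem exists_norm_mul_mul_sub_le (L : Matrix (Fin n) (Fin n) ℝ) {η : ℝ} (hη : 0 < η) :
    ∃ μ > 0, ∀ M M' X E : Matrix (Fin n) (Fin n) ℝ, ‖M - L‖ ≤ μ → ‖M' - L‖ ≤ μ →
      ‖E‖ ≤ μ * ‖X‖ → ‖M * (X + E) * M'ᵀ - L * X * Lᵀ‖ ≤ η * ‖X‖ := by
  set b := ‖L‖ + 1 with hb
  have hb0 : 0 < b := by positivity
  refine ⟨min 1 (η / (b + b + b * b)), by positivity, fun M M' X E hM hM' hE => ?_⟩
  set μ := min 1 (η / (b + b + b * b)) with hμ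
  have hμ0 : 0 < μ := by positivity
  have hμ1 : μ ≤ 1 := min_le_left _ _
  have hμη : μ * (b + b + b * b) ≤ η :=
    (le_div_iff₀ (by positivity)).1 (min_le_right _ _)
  have hMb : ‖M‖ ≤ b := by
    have := norm_add_le (M - L) L
    rw [sub_add_cancel] at this; linarith
  have hMb' : ‖M'‖ ≤ b := by
    have := norm_add_le (M' - L) L
    rw [sub_add_cancel] at this; linarith
  have h3 : ∀ F G H : Matrix (Fin n) (Fin n) ℝ, ‖F * G * Hᵀ‖ ≤ ‖F‖ * ‖G‖ * ‖H‖ := fun F G H =>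
    calc ‖F * G * Hᵀ‖ ≤ ‖F * G‖ * ‖Hᵀ‖ := norm_mul_le _ _
      _ ≤ ‖F‖ * ‖G‖ * ‖H‖ := by
        rw [norm_transpose]
        exact mul_le_mul_of_nonneg_right (norm_mul_le _ _) (norm_nonneg _)
  have e : M * (X + E) * M'ᵀ - L * X * Lᵀ
      = (M - L) * X * M'ᵀ + L * X * (M' - L)ᵀ + M * E * M'ᵀ := by
    simp only [Matrix.transpose_sub, mul_add, add_mul, mul_sub, sub_mul]
    abel
  rw [e]
  have hX := norm_nonneg X
  have k1 : ‖(M - L) * X * M'ᵀ‖ ≤ μ * ‖X‖ * b := (h3 _ _ _).trans (by gcongr)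
  have k2 : ‖L * X * (M' - L)ᵀ‖ ≤ b * ‖X‖ * μ := (h3 _ _ _).trans (by gcongr; linarith)
  have k3 : ‖M * E * M'ᵀ‖ ≤ b * (μ * ‖X‖) * b := (h3 _ _ _).trans (by gcongr)
  calc _ ≤ μ * ‖X‖ * b + b * ‖X‖ * μ + b * (μ * ‖X‖) * b :=
        (norm_add₃_le).trans (add_le_add (add_le_add k1 k2) k3)
    _ = μ * (b + b + b * b) * ‖X‖ := by ring
    _ ≤ η * ‖X‖ := by gcongr

/-- A nearly linear recursion `X ↦ L X Lᵀ` stays close to the linear one over `t` steps. -/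
theorem exists_norm_sub_pow_le (L : Matrix (Fin n) (Fin n) ℝ) (t : ℕ) :
    ∃ k : ℝ, 0 ≤ k ∧ ∀ (η : ℝ) (X : ℕ → Matrix (Fin n) (Fin n) ℝ), 0 ≤ η → η ≤ 1 →
      (∀ s, ‖X (s + 1) - L * X s * Lᵀ‖ ≤ η * ‖X s‖) →
      ‖X t - L ^ t * X 0 * (L ^ t)ᵀ‖ ≤ k * η * ‖X 0‖ := by
  have h3 : ∀ F G : Matrix (Fin n) (Fin n) ℝ, ‖F * G * Fᵀ‖ ≤ ‖F‖ ^ 2 * ‖G‖ := fun F G =>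
    calc ‖F * G * Fᵀ‖ ≤ ‖F * G‖ * ‖Fᵀ‖ := norm_mul_le _ _
      _ ≤ ‖F‖ * ‖G‖ * ‖F‖ := by
        rw [norm_transpose]
        exact mul_le_mul_of_nonneg_right (norm_mul_le _ _) (norm_nonneg _)
      _ = _ := by ring
  induction t with
  | zero => exact ⟨0, le_rfl, fun η X _ _ _ => by simp⟩
  | succ t ih =>
    obtain ⟨k, hk, h⟩ := ih
    refine ⟨‖L ^ t‖ ^ 2 + k + ‖L‖ ^ 2 * k, by positivity, fun η X hη hη1 hX => ?_⟩
    have h1 := h η X hη hη1 hX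
    have h2 : ‖X t‖ ≤ (‖L ^ t‖ ^ 2 + k) * ‖X 0‖ := by
      have h4 := norm_add_le (X t - L ^ t * X 0 * (L ^ t)ᵀ) (L ^ t * X 0 * (L ^ t)ᵀ)
      rw [sub_add_cancel] at h4
      have h5 := h3 (L ^ t) (X 0)
      have h6 : k * η * ‖X 0‖ ≤ k * 1 * ‖X 0‖ := by gcongr
      linarith
    have e : X (t + 1) - L ^ (t + 1) * X 0 * (L ^ (t + 1))ᵀ
        = (X (t + 1) - L * X t * Lᵀ) + L * (X t - L ^ t * X 0 * (L ^ t)ᵀ) * Lᵀ := by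
      rw [pow_succ' L t, Matrix.transpose_mul]
      simp only [Matrix.mul_sub, Matrix.sub_mul, Matrix.mul_assoc]
      abel
    rw [e]
    calc _ ≤ η * ‖X t‖ + ‖L‖ ^ 2 * (k * η * ‖X 0‖) :=
          (norm_add_le _ _).trans (add_le_add (hX t) ((h3 _ _).trans (by gcongr)))
      _ ≤ η * ((‖L ^ t‖ ^ 2 + k) * ‖X 0‖) + ‖L‖ ^ 2 * (k * η * ‖X 0‖) := by gcongr
      _ = _ := by ring

/-- If the powers of `L` tend to `0`, every recursion close enough to `X ↦ L X Lᵀ` halves the norm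
every `j` steps. -/
theorem exists_halving {L : Matrix (Fin n) (Fin n) ℝ}
    (hL : Tendsto (fun k : ℕ => L ^ k) atTop (𝓝 0)) :
    ∃ (j : ℕ) (η : ℝ), 0 < η ∧ ∀ X : ℕ → Matrix (Fin n) (Fin n) ℝ,
      (∀ s, ‖X (s + 1) - L * X s * Lᵀ‖ ≤ η * ‖X s‖) → ∀ s, ‖X (j + s)‖ ≤ ‖X s‖ / 2 := by
  obtain ⟨j, hj⟩ := ((tendsto_zero_iff_norm_tendsto_zero.1 hL).eventually
    (gt_mem_nhds (show (0 : ℝ) < 1 / 2 by norm_num))).exists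
  obtain ⟨k, hk, h⟩ := exists_norm_sub_pow_le L j
  refine ⟨j, min 1 (1 / (4 * (k + 1))), by positivity, fun X hX s => ?_⟩
  set η := min 1 (1 / (4 * (k + 1))) with hη
  have hη0 : 0 < η := by positivity
  have hη1 : η * (4 * (k + 1)) ≤ 1 := (le_div_iff₀ (by positivity)).1 (min_le_right _ _)
  have h1 := h η (fun t => X (t + s)) hη0.le (min_le_left _ _) fun t => by
    rw [add_right_comm]
    exact hX (t + s)
  simp only [zero_add] at h1
  have h2 : ‖L ^ j * X s * (L ^ j)ᵀ‖ ≤ 1 / 4 * ‖X s‖ :=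
    calc ‖L ^ j * X s * (L ^ j)ᵀ‖ ≤ ‖L ^ j * X s‖ * ‖(L ^ j)ᵀ‖ := norm_mul_le _ _
      _ ≤ ‖L ^ j‖ * ‖X s‖ * ‖L ^ j‖ := by
        rw [norm_transpose]
        exact mul_le_mul_of_nonneg_right (norm_mul_le _ _) (norm_nonneg _)
      _ ≤ 1 / 2 * ‖X s‖ * (1 / 2) := by gcongr
      _ = _ := by ring
  have h3 := norm_add_le (X (j + s) - L ^ j * X s * (L ^ j)ᵀ) (L ^ j * X s * (L ^ j)ᵀ)
  rw [sub_add_cancel] at h3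
  have h4 : k * η * ‖X s‖ ≤ 1 / 4 * ‖X s‖ :=
    mul_le_mul_of_nonneg_right (by nlinarith) (norm_nonneg _)
  linarith

theorem summable_of_halving {a : ℕ → ℝ} (ha : ∀ t, 0 ≤ a t) {j : ℕ}
    (h : ∀ t, a (j + t) ≤ a t / 2) : Summable a := by
  refine summable_of_sum_range_le (c := 2 * ∑ t ∈ Finset.range j, a t) ha fun T => ?_
  have h1 : ∑ t ∈ Finset.range T, a t ≤ ∑ t ∈ Finset.range (j + T), a t :=
    Finset.sum_le_sum_of_subset_of_nonneg
      (Finset.range_mono (Nat.le_add_left T j)) fun i _ _ => ha i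
  rw [Finset.sum_range_add] at h1
  have h2 : ∑ t ∈ Finset.range T, a (j + t) ≤ ∑ t ∈ Finset.range T, a t / 2 :=
    Finset.sum_le_sum fun t _ => h t
  rw [← Finset.sum_div] at h2
  linarith

/-- `θ` is Lipschitz, with a small constant, on the covariances bounded below on their common
image. -/
theorem abs_theta_sub_le {Q : Matrix (Fin n) (Fin n) ℝ} (hQ : Qᵀ = Q) (hQQ : Q * Q = Q)
    (hP : 0 ≤ P) (hP' : 0 ≤ P') (hQP : Q * P = P) (hQP' : Q * P' = P') {k b : ℝ} (hk : 0 ≤ k)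
    (h : Q ≤ k • P) (h' : Q ≤ k • P') (hb : ‖P‖ ≤ b) (hb' : ‖P'‖ ≤ b) (hc : 0 < c) (hε : 0 < ε)
    (hcε : 2 * c ≤ entropyFun ε) :
    |theta c P - theta c P'| * (‖P‖ * ‖P'‖) ≤ k * (ε * b) * ‖P - P'‖ := by
  have hb0 : 0 ≤ b := (norm_nonneg P).trans hb
  -- one side of the estimate, for any two such covariances
  have key : ∀ {R S : Matrix (Fin n) (Fin n) ℝ}, 0 ≤ R → 0 ≤ S → Q * R = R → Q * S = S →
      Q ≤ k • S → ‖R‖ ≤ b → ‖S‖ ≤ b →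
      (theta c S - theta c R) * (‖R‖ * ‖S‖) ≤ k * (ε * b) * ‖R - S‖ := by
    intro R S hR hS hQR hQS hQk hRb hSb
    rcases eq_or_ne R 0 with rfl | hR0
    · simp only [norm_zero, zero_mul, mul_zero]; positivity
    rcases eq_or_ne S 0 with rfl | hS0
    · simp only [norm_zero, mul_zero]; positivity
    have hsymm : (R - S)ᵀ = R - S := by
      rw [Matrix.transpose_sub, transpose_eq_of_nonneg hR, transpose_eq_of_nonneg hS]
    have h1 : R - S ≤ ‖R - S‖ • Q := by
      have h2 := conj_mono (le_norm_smul_one hsymm) Q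
      have h3 : Q * (R - S) = R - S := by rw [mul_sub, hQR, hQS]
      have h4 : (R - S) * Q = R - S := by
        have := congrArg Matrix.transpose h3
        rwa [Matrix.transpose_mul, hsymm, hQ] at this
      rwa [hQ, h3, h4, Matrix.mul_smul, mul_one, Matrix.smul_mul, hQQ] at h2
    have h5 : R ≤ (1 + k * ‖R - S‖) • S := by
      rw [add_smul, one_smul, ← sub_le_iff_le_add']
      refine h1.trans ?_
      rw [mul_comm, mul_smul]
      exact smul_le_smul_of_nonneg_left hQk (norm_nonneg _)
    have h6 := theta_le_mul_theta hR hS hR0 hS0 (by positivity) hc h5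
    obtain ⟨h7, h8⟩ := theta_mul_norm_le hR hc hε hcε
    calc (theta c S - theta c R) * (‖R‖ * ‖S‖)
        ≤ (k * ‖R - S‖ * theta c R) * (‖R‖ * ‖S‖) := by
          gcongr
          linarith
      _ = k * ‖R - S‖ * ((theta c R * ‖R‖) * ‖S‖) := by ring
      _ ≤ k * ‖R - S‖ * (ε * b) := by gcongr
      _ = _ := by ring
  rcases abs_cases (theta c P - theta c P') with ⟨h1, -⟩ | ⟨h1, -⟩
  · rw [h1, norm_sub_rev, mul_comm ‖P‖]
    exact key hP' hP hQP' hQP h hb' hb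
  · rw [h1, neg_sub]
    exact key hP hP' hQP hQP' h' hb hb'

end Robust

/-! ### Convergence of the robust iteration -/

section Convergence
open scoped MatrixOrder Matrix.Norms.L2Operator

variable {n m p l : ℕ} {A : Matrix (Fin n) (Fin n) ℝ} {B : Matrix (Fin n) (Fin m) ℝ}
  {C : Matrix (Fin p) (Fin n) ℝ} {D : Matrix (Fin p) (Fin m) ℝ} {P : Matrix (Fin n) (Fin n) ℝ}

/-- For a small tolerance there is a time from which on all robust trajectories on the image of
the classical limit `P` lie near `P` and stay bounded below on that image. -/
theorem exists_absorption (hR : (D * Dᵀ).PosDef) (hstab : Stabilizable A B)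
    (hobs : ReachableSubsystemObservable A B C) (hP : 0 ≤ P) (hfix : riccati A B C D P = P)
    (him : im P ≤ reachableSubspace A B)
    (hlim : Tendsto (fun t : ℕ => (riccati A B C D)^[t] 0) atTop (𝓝 P))
    {U : Matrix (Fin n) (Fin l) ℝ} (hU : Uᵀ * U = 1) (hUP : im U = im P) {κ : ℝ} (hκ : 0 < κ)
    (hκP : U * Uᵀ ≤ κ • P) {δ : ℝ} (hδ : 0 < δ) :
    ∃ N : ℕ, ∀ᶠ ε in 𝓝[>] (0 : ℝ), ∀ c X, 0 < c → 2 * c ≤ entropyFun ε → 0 ≤ X →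
      U * Uᵀ * X = X → ‖(robustRiccati A B C D c)^[N] X - P‖ ≤ δ ∧
        U * Uᵀ ≤ (2 * κ) • (robustRiccati A B C D c)^[N] X := by
  obtain ⟨N₀, M, hM⟩ := exists_uniform_bound (A := A) (B := B) (C := C) hR hobs
  have hM0 : 0 ≤ M := (iterate_riccati_nonneg (A := A) (B := B) (C := C) hR le_rfl N₀).trans
    (hM 0 le_rfl (by rintro _ ⟨x, rfl⟩; simp))
  -- a perturbation of norm `κ⁻¹ / 2` at most halves the lower bound `κ⁻¹` of `P` on its image
  set δ₁ := min (δ / 4) (κ⁻¹ / 2) with hδ₁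
  have hδ₁0 : 0 < δ₁ := by positivity
  have hnear : ∀ {S : ℕ → Matrix (Fin n) (Fin n) ℝ}, Tendsto S atTop (𝓝 P) →
      ∀ᶠ t in atTop, ‖S t - P‖ < δ₁ := fun hS => by
    simpa only [dist_eq_norm] using Metric.tendsto_nhds.1 hS δ₁ hδ₁0
  obtain ⟨t, ht1, ht2⟩ := ((hnear ((tendsto_add_atTop_iff_nat N₀).2 hlim)).and
    (hnear (tendsto_iterate_riccati hR hstab hP hfix hlim hM0))).exists
  set Lo := (riccati A B C D)^[t + N₀] 0 with hLo
  set Hi := (riccati A B C D)^[t] M with hHi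
  have hLo0 : 0 ≤ Lo := iterate_riccati_nonneg hR le_rfl _
  have hLoP : ‖P - Lo‖ ≤ δ₁ := by rw [norm_sub_rev]; exact ht1.le
  have hU' : (U * Uᵀ)ᵀ = U * Uᵀ := by simp
  have hUU : U * Uᵀ * (U * Uᵀ) = U * Uᵀ := by
    rw [Matrix.mul_assoc, ← Matrix.mul_assoc Uᵀ, hU, Matrix.one_mul]
  obtain ⟨hQB, hQA⟩ := proj_mul_of_fixed hR hP hfix hU hUP
  have hlow : U * Uᵀ ≤ (2 * κ) • (U * Uᵀ * Lo * (U * Uᵀ)ᵀ) := by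
    have hQP : U * Uᵀ * P * (U * Uᵀ)ᵀ = P := by
      have h1 := proj_mul_of_im_le hU hUP.ge
      have h2 := congrArg Matrix.transpose h1
      rw [Matrix.transpose_mul, transpose_eq_of_nonneg hP] at h2
      rw [h1, h2]
    have hPT := transpose_eq_of_nonneg hP
    have hLoT := transpose_eq_of_nonneg hLo0
    have h1 : P - Lo ≤ δ₁ • 1 := (le_norm_smul_one (by rw [Matrix.transpose_sub, hPT, hLoT])).trans
      (smul_le_smul_of_nonneg_right hLoP (Matrix.nonneg_iff_posSemidef.2 Matrix.PosSemidef.one))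
    have h2 := conj_mono h1 (U * Uᵀ)
    rw [Matrix.mul_sub, Matrix.sub_mul, hQP, Matrix.mul_smul, Matrix.mul_one, Matrix.smul_mul, hU',
      hUU] at h2
    rw [hU']
    have h3 := smul_le_smul_of_nonneg_left h2 hκ.le
    have h4 : (κ * δ₁) • (U * Uᵀ) ≤ (1 / 2 : ℝ) • (U * Uᵀ) := by
      refine smul_le_smul_of_nonneg_right ?_ (mul_transpose_self_nonneg U)
      calc κ * δ₁ ≤ κ * (κ⁻¹ / 2) := by gcongr; exact min_le_right _ _
        _ = 1 / 2 := by field_simp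
    rw [smul_sub, smul_smul] at h3
    have h5 : U * Uᵀ ≤ κ • (U * Uᵀ * Lo * (U * Uᵀ)) + (1 / 2 : ℝ) • (U * Uᵀ) :=
      hκP.trans (sub_le_iff_le_add'.1 (h3.trans h4))
    have h6 : (1 / 2 : ℝ) • (U * Uᵀ) ≤ κ • (U * Uᵀ * Lo * (U * Uᵀ)) := by
      have h7 := sub_le_iff_le_add.2 h5
      have h8 : U * Uᵀ - (1 / 2 : ℝ) • (U * Uᵀ) = (1 / 2 : ℝ) • (U * Uᵀ) := by
        rw [sub_eq_iff_eq_add, ← add_smul]; norm_num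
      rwa [h8] at h7
    have h9 := smul_le_smul_of_nonneg_left h6 (zero_le_two (α := ℝ))
    rw [smul_smul, smul_smul] at h9
    simpa using h9
  have hcont : ContinuousAt (fun ε : ℝ => ‖((1 - ε)⁻¹) ^ (t + N₀) • Hi - Lo‖) 0 := by
    have h1 : ContinuousAt (fun ε : ℝ => (1 - ε)⁻¹) 0 :=
      (continuousAt_const.sub continuousAt_id).inv₀ (by simp)
    exact (((h1.pow _).smul continuousAt_const).sub continuousAt_const).norm
  have hgap : ‖((1 - (0 : ℝ))⁻¹) ^ (t + N₀) • Hi - Lo‖ < 2 * δ₁ := by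
    have h1 := norm_sub_le (Hi - P) (Lo - P)
    rw [sub_sub_sub_cancel_right] at h1
    simp only [sub_zero, inv_one, one_pow, one_smul]
    linarith
  refine ⟨t + N₀, ?_⟩
  filter_upwards [self_mem_nhdsWithin, nhdsWithin_le_nhds (gt_mem_nhds zero_lt_one),
    nhdsWithin_le_nhds (hcont.eventually (gt_mem_nhds hgap))] with ε hε hε1 hεgap c X hc hcε hX hQX
  have hε0 : 0 < ε := hε
  obtain ⟨h1, h2⟩ := iterate_robustRiccati_bounds (A := A) (B := B) (C := C) hR hX hc hε0 hε1 hcε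
    (t + N₀)
  have h3 : Lo ≤ (robustRiccati A B C D c)^[t + N₀] X :=
    (iterate_riccati_mono hR le_rfl hX _).trans h1
  have hXim : im X ≤ reachableSubspace A B := by
    rw [← hQX, Matrix.mul_assoc]
    exact (im_mul_le U _).trans (hUP.le.trans him)
  have h4 : (riccati A B C D)^[t + N₀] X ≤ Hi := by
    rw [Function.iterate_add_apply]
    exact iterate_riccati_mono hR (iterate_riccati_nonneg hR hX _) (hM X hX hXim) t
  have h5 : (robustRiccati A B C D c)^[t + N₀] X ≤ ((1 - ε)⁻¹) ^ (t + N₀) • Hi :=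
    h2.trans (smul_le_smul_of_nonneg_left h4 (pow_nonneg (inv_nonneg.2 (by linarith)) _))
  have hQF := proj_mul_iterate_robustRiccati hQB hQA hR hX hQX hc hε0 hε1 hcε (C := C) (t + N₀)
  constructor
  · have h6 := norm_le_norm_of_le (sub_nonneg.2 h3) (sub_le_sub_right h5 Lo)
    have h7 := norm_add_le ((robustRiccati A B C D c)^[t + N₀] X - Lo) (Lo - P)
    rw [sub_add_sub_cancel] at h7
    have h8 : δ₁ ≤ δ / 4 := min_le_left _ _
    linarith
  · have h6 := conj_mono h3 (U * Uᵀ)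
    have h7 := congrArg Matrix.transpose hQF
    rw [Matrix.transpose_mul, transpose_eq_of_nonneg (hLo0.trans h3)] at h7
    rw [hQF, h7] at h6
    exact hlow.trans (smul_le_smul_of_nonneg_left h6 (by positivity))

/-- The robust iteration on the image of the classical limit converges, for all small
tolerances, to a limit that does not depend on the initial covariance. -/
theorem exists_tendsto_iterate_robustRiccati (hR : (D * Dᵀ).PosDef) (hstab : Stabilizable A B)
    (hobs : ReachableSubsystemObservable A B C) (hP : 0 ≤ P) (hfix : riccati A B C D P = P)
    (him : im P ≤ reachableSubspace A B)
    (hlim : Tendsto (fun t : ℕ => (riccati A B C D)^[t] 0) atTop (𝓝 P))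
    {U : Matrix (Fin n) (Fin l) ℝ} (hU : Uᵀ * U = 1) (hUP : im U = im P) :
    ∃ κ > 0, ∃ cMax > 0, ∀ c, 0 < c → c < cMax → ∃ Pinf : Matrix (Fin n) (Fin n) ℝ,
      U * Uᵀ ≤ (κ : ℝ) • Pinf ∧ ∀ X, 0 ≤ X → U * Uᵀ * X = X →
        Tendsto (fun t : ℕ => (robustRiccati A B C D c)^[t] X) atTop (𝓝 Pinf) := by
  obtain ⟨κ, hκ, hκP⟩ := exists_proj_le_smul hP hUP.le
  obtain ⟨j, η, hη, hhalf⟩ := exists_halving (tendsto_pow_closedLoop hR hstab hP hfix)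
  obtain ⟨μ, hμ, hprod⟩ := exists_norm_mul_mul_sub_le (closedLoop A C D P) hη
  obtain ⟨δ, hδ, hloop⟩ := exists_norm_robustLoop_sub_le (A := A) (C := C) hR hP hμ
  obtain ⟨N, hN⟩ := exists_absorption hR hstab hobs hP hfix him hlim hU hUP hκ hκP hδ
  set b := ‖P‖ + δ with hb
  have hev1 : ∀ᶠ ε in 𝓝[>] (0 : ℝ), ε / (1 - ε) < δ := by
    have h1 : ContinuousAt (fun ε : ℝ => ε / (1 - ε)) 0 :=
      continuousAt_id.div (continuousAt_const.sub continuousAt_id) (by simp)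
    exact nhdsWithin_le_nhds (h1.eventually (gt_mem_nhds (by simpa using hδ)))
  have hev2 : ∀ᶠ ε in 𝓝[>] (0 : ℝ), 2 * κ * (ε * b) < μ := by
    have h1 : ContinuousAt (fun ε : ℝ => 2 * κ * (ε * b)) 0 := by fun_prop
    exact nhdsWithin_le_nhds (h1.eventually (gt_mem_nhds (by simpa using hμ)))
  have hev3 : ∀ᶠ ε in 𝓝[>] (0 : ℝ), 0 < ε ∧ ε < 1 :=
    (eventually_mem_nhdsWithin (s := Set.Ioi (0 : ℝ))).and
      (nhdsWithin_le_nhds (gt_mem_nhds zero_lt_one))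
  obtain ⟨ε, hNε, hε1', hεμ, hε, hε1⟩ := (hN.and (hev1.and (hev2.and hev3))).exists
  refine ⟨2 * κ, by positivity, entropyFun ε / 2, half_pos (entropyFun_pos hε hε1),
    fun c hc hcmax => ?_⟩
  have hcε : 2 * c ≤ entropyFun ε := by linarith
  obtain ⟨hQB, hQA⟩ := proj_mul_of_fixed hR hP hfix hU hUP
  have hU' : (U * Uᵀ)ᵀ = U * Uᵀ := by simp
  have hUU : U * Uᵀ * (U * Uᵀ) = U * Uᵀ := by
    rw [Matrix.mul_assoc, ← Matrix.mul_assoc Uᵀ, hU, Matrix.one_mul]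
  set F := robustRiccati A B C D c with hF
  have hnn : ∀ {X}, 0 ≤ X → ∀ t, 0 ≤ F^[t] X := fun hX t =>
    (iterate_riccati_nonneg (A := A) (B := B) (C := C) hR hX t).trans
      (iterate_robustRiccati_bounds hR hX hc hε hε1 hcε t).1
  have hQF : ∀ {X}, 0 ≤ X → U * Uᵀ * X = X → ∀ t, U * Uᵀ * F^[t] X = F^[t] X := fun hX hQX t =>
    proj_mul_iterate_robustRiccati hQB hQA hR hX hQX hc hε hε1 hcε t
  have habs : ∀ {X}, 0 ≤ X → U * Uᵀ * X = X → ∀ t,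
      ‖F^[N + t] X - P‖ ≤ δ ∧ U * Uᵀ ≤ (2 * κ) • F^[N + t] X := fun {X} hX hQX t => by
    rw [Function.iterate_add_apply]
    exact hNε c _ hc hcε (hnn hX t) (hQF hX hQX t)
  have hbd : ∀ {Y : Matrix (Fin n) (Fin n) ℝ}, ‖Y - P‖ ≤ δ → ‖Y‖ ≤ b := fun {Y} hY => by
    have := norm_add_le (Y - P) P
    rw [sub_add_cancel] at this
    linarith
  have hsum : ∀ {X Y}, 0 ≤ X → 0 ≤ Y → U * Uᵀ * X = X → U * Uᵀ * Y = Y →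
      Summable fun t => ‖F^[N + t] X - F^[N + t] Y‖ := by
    intro X Y hX hY hQX hQY
    refine summable_of_halving (fun t => norm_nonneg _)
      (hhalf (fun t => F^[N + t] X - F^[N + t] Y) fun t => ?_)
    obtain ⟨hx1, hx2⟩ := habs hX hQX t
    obtain ⟨hy1, hy2⟩ := habs hY hQY t
    have hx0 := hnn hX (N + t)
    have hy0 := hnn hY (N + t)
    have hxQ := hQF hX hQX (N + t)
    have hyQ := hQF hY hQY (N + t)
    rw [← add_assoc, Function.iterate_succ_apply', Function.iterate_succ_apply']
    generalize F^[N + t] X = x at *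
    generalize F^[N + t] Y = y at *
    rw [hF, robustRiccati_sub hR hx0 hy0 hc hε hε1 hcε]
    refine hprod _ _ _ _
      (hloop x _ hx1 ((norm_amp_sub_one_le hx0 hc hε hε1 hcε).trans hε1'.le))
      (hloop y _ hy1 ((norm_amp_sub_one_le hy0 hc hε hε1 hcε).trans hε1'.le)) ?_
    rw [norm_smul, Real.norm_eq_abs]
    calc |theta c x - theta c y| * ‖x * y‖ ≤ |theta c x - theta c y| * (‖x‖ * ‖y‖) := by
          gcongr; exact norm_mul_le _ _
      _ ≤ 2 * κ * (ε * b) * ‖x - y‖ :=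
          abs_theta_sub_le hU' hUU hx0 hy0 hxQ hyQ (by positivity) hx2 hy2 (hbd hx1) (hbd hy1)
            hc hε hcε
      _ ≤ μ * ‖x - y‖ := by gcongr
  -- consecutive iterates are two trajectories, so the one from `0` is Cauchy
  have hcauchy : CauchySeq fun t => F^[N + t] 0 := by
    refine cauchySeq_of_summable_dist ?_
    have h1 := hsum (X := 0) (Y := F 0) le_rfl (hnn le_rfl 1) (by simp) (hQF le_rfl (by simp) 1)
    refine h1.congr fun t => ?_
    rw [dist_eq_norm, Nat.add_succ, Function.iterate_succ_apply]
  obtain ⟨Pinf, hPinf⟩ := cauchySeq_tendsto_of_complete hcauchy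
  refine ⟨Pinf, ?_, fun X hX hQX => ?_⟩
  · exact le_of_tendsto_of_forall_le (fun t => (habs le_rfl (by simp) t).2) tendsto_const_nhds
      (hPinf.const_smul (2 * κ))
  · rw [← tendsto_add_atTop_iff_nat N]
    have h1 := (hsum hX le_rfl hQX (by simp)).tendsto_atTop_zero
    have h2 := (tendsto_zero_iff_norm_tendsto_zero.2 h1).add hPinf
    simpa [add_comm N] using h2

end Convergence

end LowRankRiccati

end

theorem proposition2 {n m p : ℕ}
    (A : Matrix (Fin n) (Fin n) ℝ) (B : Matrix (Fin n) (Fin m) ℝ)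
    (C : Matrix (Fin p) (Fin n) ℝ) (D : Matrix (Fin p) (Fin m) ℝ)
    (hR : (D * D.transpose).PosDef) (hBD : B * D.transpose = 0)
    (hstab : LowRankRiccati.Stabilizable A B)
    (hobs : LowRankRiccati.ReachableSubsystemObservable A B C) :
    ∃ Pbar : Matrix (Fin n) (Fin n) ℝ,
      (∀ P₀ : Matrix (Fin n) (Fin n) ℝ, P₀.PosSemidef →
        Tendsto (fun t : ℕ => (LowRankRiccati.riccati A B C D)^[t] P₀) atTop (𝓝 Pbar)) ∧
      ∀ (l : ℕ) (U : Matrix (Fin n) (Fin l) ℝ), U.transpose * U = 1 →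
        LowRankRiccati.im U = LowRankRiccati.im Pbar →
        ∃ cMax : ℝ, 0 < cMax ∧ ∀ c : ℝ, 0 < c → c < cMax →
          ∃! PinfR : Matrix (Fin l) (Fin l) ℝ, PinfR.PosDef ∧
            ∀ P₀ : Matrix (Fin n) (Fin n) ℝ, P₀.PosSemidef →
              LowRankRiccati.im P₀ ≤ LowRankRiccati.im U →
              Tendsto
                (fun t : ℕ =>
                  U.transpose * (LowRankRiccati.robustRiccati A B C D c)^[t] P₀ * U)
                atTop (𝓝 PinfR) := by
  obtain ⟨P, hP, hfix, him, hlim⟩ := LowRankRiccati.exists_tendsto_iterate_zero hR hobs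
  refine ⟨P, fun P₀ hP₀ => LowRankRiccati.tendsto_iterate_riccati hR hstab hP hfix hlim
    (Matrix.nonneg_iff_posSemidef.2 hP₀), fun l U hU hUP => ?_⟩
  obtain ⟨κ, hκ, cMax, hcMax, h⟩ := LowRankRiccati.exists_tendsto_iterate_robustRiccati hR hstab
    hobs hP hfix him hlim hU hUP
  refine ⟨cMax, hcMax, fun c hc hc' => ?_⟩
  obtain ⟨Pinf, hpos, hconv⟩ := h c hc hc'
  have hconv' : ∀ P₀ : Matrix (Fin n) (Fin n) ℝ, P₀.PosSemidef →
      LowRankRiccati.im P₀ ≤ LowRankRiccati.im U →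
      Tendsto (fun t : ℕ => U.transpose * (LowRankRiccati.robustRiccati A B C D c)^[t] P₀ * U)
        atTop (𝓝 (U.transpose * Pinf * U)) := fun P₀ hP₀ hP₀U => by
    have hcont : Continuous fun M : Matrix (Fin n) (Fin n) ℝ => U.transpose * M * U := by fun_prop
    exact (hcont.tendsto Pinf).comp (hconv P₀ (Matrix.nonneg_iff_posSemidef.2 hP₀)
      (LowRankRiccati.proj_mul_of_im_le hU hP₀U))
  refine ⟨U.transpose * Pinf * U, ⟨?_, hconv'⟩, fun R hR' => ?_⟩
  · have h1 := LowRankRiccati.conj_mono hpos U.transpose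
    have h2 : U.transpose * (U * U.transpose) * U.transpose.transpose = 1 := by
      rw [Matrix.transpose_transpose, ← Matrix.mul_assoc, hU, Matrix.one_mul, hU]
    rw [h2, Matrix.mul_smul, Matrix.smul_mul, Matrix.transpose_transpose] at h1
    have h3 : (κ • (U.transpose * Pinf * U)).PosDef := by
      have := Matrix.PosDef.one.add_posSemidef (Matrix.le_iff.1 h1)
      rwa [add_sub_cancel] at this
    have h4 := h3.smul (inv_pos.2 hκ)
    rwa [smul_smul, inv_mul_cancel₀ hκ.ne', one_smul] at h4
  · have h0 : LowRankRiccati.im (0 : Matrix (Fin n) (Fin n) ℝ) ≤ LowRankRiccati.im U := by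
      rintro _ ⟨x, rfl⟩
      simp
    exact tendsto_nhds_unique (hR'.2 0 Matrix.PosSemidef.zero h0)
      (hconv' 0 Matrix.PosSemidef.zero h0)
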